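/- **Setting.** Let $m\ge 1$, $n\ge 2$, $1\le k\le d$. Given are points $x^l_i,y_j\in\mathbb R^d$ ($l\in[m]$, $i,j\in[n]$), probability vectors $p^l\in\mathbb R^n$ with positive entries, and weights $\omega^l\ge 0$, $\sum_l\omega^l=1$. Put $\bar c=\max_{l,i,j}\|x^l_i-y_j\|^2$, $\mathrm{St}(d,k)=\{U\in\mathbb R^{d\times k}: U^\top U=I_k\}$, let $\Pi(\mathbf p)$ be the set of all $\pi=(\pi^l)_{l\in[m]}$ with $\pi^l\in\mathbb R_+^{n\times n}$, $\pi^l\mathbf 1=p^l$ and $(\pi^l)^\top\mathbf 1$ independent of $l$, and let $f(\pi,U)=\sum_l\omega^l\sum_{i,j}\pi^l_{ij}\|U^\top(x^l_i-y_j)\|^2$. An $\varepsilon$-stationary point of $\max_{U\in\mathrm{St}(d,k)}\min_{\pi\in\Pi(\mathbf p)}f(\pi,U)$ is a pair $(\hat\pi,\hat U)\in\Pi(\mathbf p)\times\mathrm{St}(d,k)$ with $\|\mathrm{grad}_Uf(\hat\pi,\hat U)\|_F\le\varepsilon$ (Riemannian gradient on $\mathrm{St}(d,k)$) and $f(\hat\pi,\hat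 U)-\min_{\pi\in\Pi(\mathbf p)}f(\pi,\hat U)\le\varepsilon$. Let $\mathrm{Retr}$ be a (smooth) retraction on $\mathrm{St}(d,k)$, and let $L_1\ge 1$, $L_2>0$ be such that $\|\mathrm{Retr}_U(\xi)-U\|_F\le L_1\|\xi\|_F$ and $\|\mathrm{Retr}_U(\xi)-(U+\xi)\|_F\le L_2\|\xi\|_F^2$ for all $U\in\mathrm{St}(d,k)$ and all tangent vectors $\xi$ at $U$ (the condition $L_1\ge1$ is automatic unless $d=k=1$). Suppose that $\mathrm{Retr}_U(\xi)$ is evaluated with at most $A(dk^2+k^3)$ arithmetic operations. **Algorithm RGA-IBP.** Given $\varepsilon>0$, set $\eta=\frac{\varepsilon}{4\log n+2}$, $\rho=2\bar c+\frac{4\bar c^2}{\eta}$, $\tau=\frac1{8L_2\bar c+2\rho L_1^2}$, and choose $U_0\in\mathrm{St}(d,k)$. For $t=0,1,2,\dots$: let $\pi_{t+1}=\mathrm{IBP}(U_t)$; $\xi_{t+1}=\mathrm{Proj}_{T_{U_t}\mathrm{St}(d,k)}(2V_{\pi_{t+1}}U_t)$, where $V_\pi=\sum_l\omega^l\sum_{i,j}\pi^l_{ij}(x^l_i-y_j)(x^l_i-y_j)^\top$;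 $U_{t+1}=\mathrm{Retr}_{U_t}(\tau\xi_{t+1})$; if $\|\xi_{t+1}\|_F\le\varepsilon$, stop and output $(\pi_{t+1},U_t)$. *Subroutine $\mathrm{IBP}(U)$.* Start with any $u_0,v_0\in\mathbb R^{m\times n}$ such that $\sum_l\omega^lv_0^l=0$ (they may change from call to call). With $\zeta^l(u,v)_{ij}=\exp(-\|U^\top(x^l_i-y_j)\|^2/\eta+u^l_i+v^l_j)$, for $s=0,1,\dots$ let $c^l=\zeta^l(u_s,v_s)^\top\mathbf 1$, $g=\exp(\sum_l\omega^l\log c^l)$, $v^l_{s+1}=v^l_s+\log(g/c^l)$, $u^l_{s+1}=u^l_s+\log\big(p^l/(\zeta^l(u_s,v_{s+1})\mathbf 1)\big)$ (entrywise), $q^l=\zeta^l(u_{s+1},v_{s+1})^\top\mathbf 1$, $\bar q=\sum_l\omega^lq^l$; stop as soon as $\sum_l\omega^l\|q^l-\bar q\|_1\le\frac{\eta\varepsilon^2}{200\bar c^3}$ and return $\hat\pi^l=\mathrm{Round}(\zeta^l(u_{s+1},v_{s+1}),p^l,\bar q)$, $l\in[m]$. *$\mathrm{Round}(\pi,p,q)$.*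 Let $\pi'=\mathrm{Diag}(x)\pi$ with $x_i=\min\{p_i/(\pi\mathbf 1)_i,1\}$, and $\pi''=\pi'\,\mathrm{Diag}(y)$ with $y_j=\min\{q_j/((\pi')^\top\mathbf 1)_j,1\}$; return $\pi''+e_pe_q^\top/\|e_p\|_1$, where $e_p=p-\pi''\mathbf 1$, $e_q=q-(\pi'')^\top\mathbf 1$ (the last term is $0$ if $e_p=0$). The operations $+,-,\times,\div,\exp,\log,\sqrt{\ },|\cdot|,\min$, and comparisons of real numbers count as one arithmetic operation each. **Claim.** For all $A,\kappa$ there is a constant $C$, depending only on $A$ and $\kappa$, such that for all data as above with $0<\varepsilon\le\bar c$, $L_2\varepsilon\le\kappa L_1^2\bar c$ and $k\le\kappa mn^2$: 1. Each iteration of RGA-IBP (from any $U_t\in\mathrm{St}(d,k)$) terminates and costs at most $C\big(mn^2dk+mn^2\bar c^6\log(n)^2\varepsilon^{-6}\big)$ arithmetic operations. 2. For every $U_0\in\mathrm{St}(d,k)$, RGA-IBP terminates with an $\varepsilon$-stationary point, and its total number of arithmetic operations (including the computation of the parameters) is at most $$\log(n)^2L_1^2\bar c^4k\cdot C\big(mn^2dk\,\varepsilon^{-4}+mn^2\bar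 c^6\log(n)^2\varepsilon^{-10}\big).$$ -/

import Mathlib

open scoped Matrix ContDiff Topology

attribute [local instance] Matrix.frobeniusNormedAddCommGroup Matrix.frobeniusNormedSpace

noncomputable section

namespace RPRWB

/-! ## Counting arithmetic operations -/

/-- The result of a straight-line computation with real numbers, together with the number of
elementary operations that were spent on it. -/
structure Counted (α : Type) : Type where
  val : α
  ops : ℕ

/-- Returning a value is free; the costs of consecutive computations add up. -/
instance : Monad Counted where
  pure a := ⟨a, 0⟩
  bind x f := ⟨(f x.val).val, x.ops + (f x.val).ops⟩

/-! The elementary operations, each of unit cost. -/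

def cAdd (a b : ℝ) : Counted ℝ := ⟨a + b, 1⟩
def cSub (a b : ℝ) : Counted ℝ := ⟨a - b, 1⟩
def cMul (a b : ℝ) : Counted ℝ := ⟨a * b, 1⟩
def cDiv (a b : ℝ) : Counted ℝ := ⟨a / b, 1⟩
def cExp (a : ℝ) : Counted ℝ := ⟨Real.exp a, 1⟩
def cLog (a : ℝ) : Counted ℝ := ⟨Real.log a, 1⟩
def cSqrt (a : ℝ) : Counted ℝ := ⟨Real.sqrt a, 1⟩
def cAbs (a : ℝ) : Counted ℝ := ⟨|a|, 1⟩
def cMin (a b : ℝ) : Counted ℝ := ⟨min a b, 1⟩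
def cLe (a b : ℝ) : Counted Bool := ⟨decide (a ≤ b), 1⟩

/-- Compute all entries of a finite family; the costs of the entries add up. -/
def cAll {ι α : Type} [Fintype ι] (f : ι → Counted α) : Counted (ι → α) :=
  ⟨fun i => (f i).val, ∑ i, (f i).ops⟩

/-- Compute the entries of a matrix. -/
def cMatrix {ι κ : Type} [Fintype ι] [Fintype κ] (f : ι → κ → Counted ℝ) :
    Counted (Matrix ι κ ℝ) :=
  ⟨Matrix.of fun i j => (f i j).val, ∑ i, ∑ j, (f i j).ops⟩

/-- Compute the terms of a finite sum and add them up, one addition for each term. -/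
def cSum {ι : Type} [Fintype ι] (f : ι → Counted ℝ) : Counted ℝ :=
  ⟨∑ i, (f i).val, ∑ i, (f i).ops + Fintype.card ι⟩

/-- Compute the entries of a finite family and their maximum, one comparison for each entry. -/
def cMax {ι : Type} [Fintype ι] (f : ι → Counted ℝ) : Counted ℝ :=
  ⟨⨆ i, (f i).val, ∑ i, (f i).ops + Fintype.card ι⟩

/-- One pass through the body of a loop. The state consists of the iteration number, the current
value of the variables, and the number of operations spent so far; `Sum.inl b` in the body breaks
out of the loop with result `b`, and `Sum.inr s` goes on with the value `s`. -/
def cLoopStep {σ β : Type} (body : ℕ → σ → Part (Counted (β ⊕ σ))) :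
    ℕ × σ × ℕ →. Counted β ⊕ (ℕ × σ × ℕ) :=
  fun z => (body z.1 z.2.1).map fun r =>
    match r.val with
    | Sum.inl b => Sum.inl ⟨b, z.2.2 + r.ops⟩
    | Sum.inr s => Sum.inr (z.1 + 1, s, z.2.2 + r.ops)

/-- The loop `for t = 0, 1, 2, …` with the given body. The cost is the sum of the costs of all
iterations that were carried out. The value is undefined if some iteration is undefined, or if the
loop never breaks. -/
def cLoop {σ β : Type} (body : ℕ → σ → Part (Counted (β ⊕ σ))) (s₀ : σ) : Part (Counted β) :=
  (cLoopStep body).fix (0, s₀, 0)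

/-! ## The Stiefel manifold and retractions -/

/-- The Stiefel manifold `St(d, k)`. -/
def Stiefel (d k : ℕ) : Set (Matrix (Fin d) (Fin k) ℝ) := {U | Uᵀ * U = 1}

/-- The tangent space of the Stiefel manifold at `U`. -/
def tangentSpace {d k : ℕ} (U : Matrix (Fin d) (Fin k) ℝ) : Set (Matrix (Fin d) (Fin k) ℝ) :=
  {ξ | Uᵀ * ξ + ξᵀ * U = 0}

/-- The orthogonal projection (for the Frobenius inner product) onto the tangent space at `U`. -/
def tangentProj {d k : ℕ} (U G : Matrix (Fin d) (Fin k) ℝ) : Matrix (Fin d) (Fin k) ℝ :=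
  G - U * ((1 / 2 : ℝ) • (Uᵀ * G + Gᵀ * U))

/-- A retraction on the Stiefel manifold. Only the values `Retr U ξ` with `U` in the manifold and
`ξ` tangent at `U` matter. The norm is the Frobenius norm. -/
structure IsRetraction {d k : ℕ}
    (Retr : Matrix (Fin d) (Fin k) ℝ → Matrix (Fin d) (Fin k) ℝ → Matrix (Fin d) (Fin k) ℝ) :
    Prop where
  mem : ∀ U ∈ Stiefel d k, ∀ ξ ∈ tangentSpace U, Retr U ξ ∈ Stiefel d k
  smooth : ContDiffOn ℝ ∞
    (fun z : Matrix (Fin d) (Fin k) ℝ × Matrix (Fin d) (Fin k) ℝ => Retr z.1 z.2)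
    {z | z.1 ∈ Stiefel d k ∧ z.2 ∈ tangentSpace z.1}
  zero : ∀ U ∈ Stiefel d k, Retr U 0 = U
  first_order : ∀ U ∈ Stiefel d k,
    Filter.Tendsto (fun ξ => ‖Retr U ξ - (U + ξ)‖ / ‖ξ‖) (𝓝[tangentSpace U \ {0}] 0) (𝓝 0)

/-! ## The fixed-support relaxed projection robust Wasserstein barycenter problem -/

/-- The data: `m` discrete measures `μ^l = ∑ i, p^l_i δ_{x^l_i}` with `n` atoms in `ℝ^d`, the
support `y_1, …, y_n` of the barycenter, and the weights `ω^l = weight l`, with `ω ∈ Δ^m`. -/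
structure Data (m n d : ℕ) where
  x : Fin m → Fin n → Fin d → ℝ
  p : Fin m → Fin n → ℝ
  y : Fin n → Fin d → ℝ
  weight : Fin m → ℝ
  p_pos : ∀ l i, 0 < p l i
  p_sum : ∀ l, ∑ i, p l i = 1
  weight_nonneg : ∀ l, 0 ≤ weight l
  weight_sum : ∑ l, weight l = 1

variable {m n d k : ℕ}

/-- `C^l_{ij} = ‖x^l_i - y_j‖²`. -/
def Data.cost (D : Data m n d) (l : Fin m) (i j : Fin n) : ℝ := ∑ a, (D.x l i a - D.y j a) ^ 2

/-- `c̄ = max_l ‖C^l‖_∞`. -/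
def Data.cbar (D : Data m n d) : ℝ := ⨆ z : Fin m × Fin n × Fin n, D.cost z.1 z.2.1 z.2.2

/-- `‖Uᵀ (x^l_i - y_j)‖²`. -/
def Data.projCost (D : Data m n d) (U : Matrix (Fin d) (Fin k) ℝ) (l : Fin m) (i j : Fin n) : ℝ :=
  ∑ b, (∑ a, U a b * (D.x l i a - D.y j a)) ^ 2

/-- `f(π, U) = ∑ l, ω^l ∑ i j, π^l_{ij} ‖Uᵀ (x^l_i - y_j)‖²`. -/
def Data.f (D : Data m n d) (π : Fin m → Matrix (Fin n) (Fin n) ℝ)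
    (U : Matrix (Fin d) (Fin k) ℝ) : ℝ :=
  ∑ l, D.weight l * ∑ i, ∑ j, π l i j * D.projCost U l i j

/-- `Π(p)`: families of nonnegative matrices with row sums `p^l` and equal column sums. -/
def Data.couplings (D : Data m n d) : Set (Fin m → Matrix (Fin n) (Fin n) ℝ) :=
  {π | (∀ l i j, 0 ≤ π l i j) ∧ (∀ l i, ∑ j, π l i j = D.p l i) ∧
    ∀ l l' j, ∑ i, π l i j = ∑ i, π l' i j}

/-- The Euclidean gradient, as the matrix of partial derivatives. -/
def euclideanGrad (F : Matrix (Fin d) (Fin k) ℝ → ℝ) (U : Matrix (Fin d) (Fin k) ℝ) :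
    Matrix (Fin d) (Fin k) ℝ :=
  Matrix.of fun a b => deriv (fun s : ℝ => F (U + s • Matrix.single a b 1)) 0

/-- `grad_U f(π, U)`: the Riemannian gradient on the Stiefel manifold. -/
def Data.riemannianGrad (D : Data m n d) (π : Fin m → Matrix (Fin n) (Fin n) ℝ)
    (U : Matrix (Fin d) (Fin k) ℝ) : Matrix (Fin d) (Fin k) ℝ :=
  tangentProj U (euclideanGrad (D.f π) U)

/-- `(π, U)` is an `ε`-stationary point of `max_{U ∈ St(d,k)} min_{π ∈ Π(p)} f(π, U)`. -/
def Data.IsStationary (D : Data m n d) (ε : ℝ)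
    (z : (Fin m → Matrix (Fin n) (Fin n) ℝ) × Matrix (Fin d) (Fin k) ℝ) : Prop :=
  z.1 ∈ D.couplings ∧ z.2 ∈ Stiefel d k ∧ ‖D.riemannianGrad z.1 z.2‖ ≤ ε ∧
    ∀ π' ∈ D.couplings, D.f z.1 z.2 - D.f π' z.2 ≤ ε

/-! ## The rounding procedure and the iterative Bregman projections -/

/-- `Round(π, p, q)`. If `err_p = 0`, the rank-one correction is `0`. -/
def roundAlg (π : Matrix (Fin n) (Fin n) ℝ) (p q : Fin n → ℝ) :
    Counted (Matrix (Fin n) (Fin n) ℝ) := do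
  let r ← cAll fun i => cSum fun j => pure (π i j)
  let x ← cAll fun i => do cMin (← cDiv (p i) (r i)) 1
  let π₁ ← cMatrix fun i j => cMul (x i) (π i j)
  let c ← cAll fun j => cSum fun i => pure (π₁ i j)
  let y ← cAll fun j => do cMin (← cDiv (q j) (c j)) 1
  let π₂ ← cMatrix fun i j => cMul (π₁ i j) (y j)
  let errp ← cAll fun i => do cSub (p i) (← cSum fun j => pure (π₂ i j))
  let errq ← cAll fun j => do cSub (q j) (← cSum fun i => pure (π₂ i j))
  let nrm ← cSum fun i => cAbs (errp i)
  cMatrix fun i j => do cAdd (π₂ i j) (← cDiv (← cMul (errp i) (errq j)) nrm)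

/-- The matrices `‖Uᵀ (x^l_i - y_j)‖²`. -/
def projCostAlg (D : Data m n d) (U : Matrix (Fin d) (Fin k) ℝ) :
    Counted (Fin m → Matrix (Fin n) (Fin n) ℝ) :=
  cAll fun l => cMatrix fun i j => cSum fun b => do
    let w ← cSum fun a => do cMul (U a b) (← cSub (D.x l i a) (D.y j a))
    cMul w w

/-- The matrices `exp(-M^l_{ij} / η + u^l_i + v^l_j)`. -/
def zetaAlg (η : ℝ) (M : Fin m → Matrix (Fin n) (Fin n) ℝ) (u v : Fin m → Fin n → ℝ) :
    Counted (Fin m → Matrix (Fin n) (Fin n) ℝ) :=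
  cAll fun l => cMatrix fun i j => do
    cExp (← cSub (← cAdd (u l i) (v l j)) (← cDiv (M l i j) η))

/-- One iteration of the iterative Bregman projections. The `v`-step turns the column sums of all
plans into their weighted geometric mean `g`, and the `u`-step turns the row sums into `p^l`. The
column sums `q^l` of the new plans decide whether to stop; on stopping, the plans are rounded to the
row sums `p^l` and the common column sums `∑ l, ω^l q^l`. -/
def ibpIter (D : Data m n d) (η thr : ℝ) (M : Fin m → Matrix (Fin n) (Fin n) ℝ)
    (s : (Fin m → Fin n → ℝ) × (Fin m → Fin n → ℝ)) :
    Counted ((Fin m → Matrix (Fin n) (Fin n) ℝ) ⊕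
      ((Fin m → Fin n → ℝ) × (Fin m → Fin n → ℝ))) := do
  let ζ ← zetaAlg η M s.1 s.2
  let c ← cAll fun l => cAll fun j => cSum fun i => pure (ζ l i j)
  let g ← cAll fun j => do
    cExp (← cSum fun l => do cMul (D.weight l) (← cLog (c l j)))
  let v ← cAll fun l => cAll fun j => do cAdd (s.2 l j) (← cLog (← cDiv (g j) (c l j)))
  let ζ' ← zetaAlg η M s.1 v
  let r ← cAll fun l => cAll fun i => cSum fun j => pure (ζ' l i j)
  let u ← cAll fun l => cAll fun i => do cAdd (s.1 l i) (← cLog (← cDiv (D.p l i) (r l i)))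
  let π ← zetaAlg η M u v
  let q ← cAll fun l => cAll fun j => cSum fun i => pure (π l i j)
  let qbar ← cAll fun j => cSum fun l => cMul (D.weight l) (q l j)
  let err ← cSum fun l => do
    cMul (D.weight l) (← cSum fun j => do cAbs (← cSub (q l j) (qbar j)))
  let halt ← cLe err thr
  if halt then do
    let out ← cAll fun l => roundAlg (π l) (D.p l) qbar
    return Sum.inl out
  else
    return Sum.inr (u, v)

/-- The subroutine `IBPsolver`, started at `(u₀, v₀)` and stopped as soon as
`∑ l, ω^l ‖q^l - q̄‖₁ ≤ thr`. -/
def ibpSolver (D : Data m n d) (η thr : ℝ) (U : Matrix (Fin d) (Fin k) ℝ)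
    (u₀ v₀ : Fin m → Fin n → ℝ) : Part (Counted (Fin m → Matrix (Fin n) (Fin n) ℝ)) :=
  let M := projCostAlg D U
  (cLoop (fun _ s => Part.some (ibpIter D η thr M.val s)) (u₀, v₀)).map fun r => do
    let _ ← M
    r

/-! ## Riemannian gradient ascent with iterative Bregman projections -/

/-- The parameters of the algorithm: the regularization `η`, the step size `τ`, and the stopping
threshold of the subroutine. -/
structure Params where
  η : ℝ
  τ : ℝ
  thr : ℝ

/-- `η = ε / (4 log n + 2)`, `ρ = 2 c̄ + 4 c̄² / η`, `τ = 1 / (8 L₂ c̄ + 2 ρ L₁²)`, and the threshold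
`η ε² / (200 c̄³)`. -/
def setParams (D : Data m n d) (L₁ L₂ ε : ℝ) : Counted Params := do
  let c ← cMax fun z : Fin m × Fin n × Fin n => cSum fun a => do
    let w ← cSub (D.x z.1 z.2.1 a) (D.y z.2.2 a)
    cMul w w
  let c2 ← cMul c c
  let c3 ← cMul c2 c
  let η ← cDiv ε (← cAdd (← cMul 4 (← cLog n)) 2)
  let ρ ← cAdd (← cMul 2 c) (← cDiv (← cMul 4 c2) η)
  let a ← cMul (← cMul 8 L₂) c
  let b ← cMul (← cMul 2 ρ) (← cMul L₁ L₁)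
  let τ ← cDiv 1 (← cAdd a b)
  let thr ← cDiv (← cMul η (← cMul ε ε)) (← cMul 200 c3)
  return ⟨η, τ, thr⟩

/-- The matrix `2 V_π U`, where `V_π = ∑ l, ω^l ∑ i j, π^l_{ij} (x^l_i - y_j) (x^l_i - y_j)ᵀ`. -/
def gradAlg (D : Data m n d) (π : Fin m → Matrix (Fin n) (Fin n) ℝ)
    (U : Matrix (Fin d) (Fin k) ℝ) : Counted (Matrix (Fin d) (Fin k) ℝ) := do
  let w ← cAll fun l => cAll fun i => cAll fun j => cAll fun b => cSum fun a => do
    cMul (← cSub (D.x l i a) (D.y j a)) (U a b)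
  cMatrix fun a b => do
    cMul 2 (← cSum fun l => do
      cMul (D.weight l) (← cSum fun i => cSum fun j => do
        cMul (π l i j) (← cMul (← cSub (D.x l i a) (D.y j a)) (w l i j b))))

/-- The projection onto the tangent space at `U`. -/
def tangentProjAlg (U G : Matrix (Fin d) (Fin k) ℝ) : Counted (Matrix (Fin d) (Fin k) ℝ) := do
  let S ← cMatrix fun b c => cSum fun a => cMul (U a b) (G a c)
  let S' ← cMatrix fun b c => do cDiv (← cAdd (S b c) (S c b)) 2
  cMatrix fun a b => do cSub (G a b) (← cSum fun c => cMul (U a c) (S' c b))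

/-- The part of an iteration that follows the call of the subroutine. -/
def ascentStep (D : Data m n d)
    (retr : Matrix (Fin d) (Fin k) ℝ → Matrix (Fin d) (Fin k) ℝ →
      Counted (Matrix (Fin d) (Fin k) ℝ))
    (ε τ : ℝ) (U : Matrix (Fin d) (Fin k) ℝ) (π : Fin m → Matrix (Fin n) (Fin n) ℝ) :
    Counted (((Fin m → Matrix (Fin n) (Fin n) ℝ) × Matrix (Fin d) (Fin k) ℝ) ⊕
      Matrix (Fin d) (Fin k) ℝ) := do
  let G ← gradAlg D π U
  let ξ ← tangentProjAlg U G
  let step ← cMatrix fun a b => cMul τ (ξ a b)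
  let U' ← retr U step
  let nrm ← cSqrt (← cSum fun a => cSum fun b => cMul (ξ a b) (ξ a b))
  let halt ← cLe nrm ε
  if halt then
    return Sum.inl (π, U)
  else
    return Sum.inr U'

/-- The `t`-th iteration of RGA-IBP, in the state `U = U_t`. Here `retr` is a procedure that
evaluates the retraction, and `(u₀ t, v₀ t)` is the initialization of the `t`-th call of the
subroutine. -/
def rgaIter (D : Data m n d)
    (retr : Matrix (Fin d) (Fin k) ℝ → Matrix (Fin d) (Fin k) ℝ →
      Counted (Matrix (Fin d) (Fin k) ℝ))
    (L₁ L₂ ε : ℝ) (u₀ v₀ : ℕ → Fin m → Fin n → ℝ) (t : ℕ) (U : Matrix (Fin d) (Fin k) ℝ) :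
    Part (Counted (((Fin m → Matrix (Fin n) (Fin n) ℝ) × Matrix (Fin d) (Fin k) ℝ) ⊕
      Matrix (Fin d) (Fin k) ℝ)) :=
  let P := (setParams D L₁ L₂ ε).val
  (ibpSolver D P.η P.thr U (u₀ t) (v₀ t)).map fun r => do
    let π ← r
    ascentStep D retr ε P.τ U π

/-- The algorithm RGA-IBP, started at `U₀`. -/
def rga (D : Data m n d)
    (retr : Matrix (Fin d) (Fin k) ℝ → Matrix (Fin d) (Fin k) ℝ →
      Counted (Matrix (Fin d) (Fin k) ℝ))
    (L₁ L₂ ε : ℝ) (u₀ v₀ : ℕ → Fin m → Fin n → ℝ) (U₀ : Matrix (Fin d) (Fin k) ℝ) :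
    Part (Counted ((Fin m → Matrix (Fin n) (Fin n) ℝ) × Matrix (Fin d) (Fin k) ℝ)) :=
  (cLoop (rgaIter D retr L₁ L₂ ε u₀ v₀) U₀).map fun r => do
    let _ ← setParams D L₁ L₂ ε
    r

end RPRWB

end

open RPRWB

namespace RPRWB

/-! ## Elementary inequalities -/

/-! For fixed `U` the inner minimum is treated through its entropic dual. At potentials `(u, v)`
whose plans have row sums `p^l` and whose `v` is balanced (weighted sum zero), the dual objective
divided by `η` is `Data.dual`. Most of the analysis rests on one inequality, `dual_sub_dual_ge`. The
Kullback–Leibler divergence from the plans `Z'` of one such state to those of another is the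
difference of the dual values, minus `1/η` times the change of the transport cost of `Z'`, plus a
cross term `⟨v' - v, q'⟩`. As `v' - v` is balanced, the cross term sees only the deviation of the
column sums from their mean. One iteration of the Bregman projections puts every `v^l` within `c̄/η`
of a constant, whatever the start (`goodState_next`), so the cross term is at most `(2c̄/η) * err`.
For equal costs the inequality says that a small `err` means a nearly optimal dual value and, by
Pinsker, nearly determined plans. For the costs of two matrices `U`, `V` it compares the regularized
values.

Inner loop: an iteration raises the dual by at least `err² / 16` (`err_sq_le_dual_next`), while the
dual gap is at most linear in `err`. `steps_le` turns this into `O(c̄ / (η thr))` iterations, with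
no dependence on the initial potentials.

Outer loop: the Lyapunov function is `η * Data.value`, a supremum of dual values. No maximizer is
needed, since `exists_good` provides states with arbitrarily small `err`. The quadratic term from
Pinsker pays for the change of the plans between `U` and `V`; hence the value behaves like a
function with curvature of order `c̄² / η`, and this is what the step size `τ` accounts for. A step
that does not stop gains at least `τ ε² / 20` (`value_gain`), and the total variation is at most
`2c̄` (`value_sub_value_le`), which bounds the number of steps. On stopping, the test is the
gradient condition of stationarity, and `pair_zeta_le` together with rounding gives the optimality
gap. The bound of the theorem is the product of the two counts with the cost of one pass. Its
exponents leave slack, absorbed by `ε ≤ c̄` and `log n ≥ 2/3`. -/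

lemma sub_le_mul_log_sub {a b : ℝ} (ha : 0 ≤ a) (hb : 0 < b) :
    a - b ≤ a * (Real.log a - Real.log b) := by
  rcases ha.eq_or_lt with rfl | ha
  · simp [hb.le]
  · have h := Real.log_le_sub_one_of_pos (div_pos hb ha)
    rw [Real.log_div hb.ne' ha.ne'] at h
    have h2 := mul_le_mul_of_nonneg_left h ha.le
    have h3 : a * (b / a - 1) = b - a := by field_simp
    linarith

/-- Apply the previous inequality to the square roots and multiply by `2√a`. The square that is kept
is a Hellinger term, the source of Pinsker's inequality below. -/
lemma sq_sqrt_sub_le_mul_log_sub {a b : ℝ} (ha : 0 < a) (hb : 0 < b) :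
    (√a - √b) ^ 2 + (a - b) ≤ a * (Real.log a - Real.log b) := by
  have h := sub_le_mul_log_sub (Real.sqrt_nonneg a) (Real.sqrt_pos.2 hb)
  rw [Real.log_sqrt ha.le, Real.log_sqrt hb.le] at h
  have h2 := mul_le_mul_of_nonneg_left h (Real.sqrt_nonneg a)
  nlinarith [Real.sq_sqrt ha.le, Real.sq_sqrt hb.le]

/-- Gibbs' inequality. -/
lemma gibbs {ι : Type*} [Fintype ι] {a b : ι → ℝ} (ha : ∀ i, 0 ≤ a i) (hb : ∀ i, 0 < b i)
    (hab : ∑ i, b i ≤ ∑ i, a i) : 0 ≤ ∑ i, a i * (Real.log (a i) - Real.log (b i)) := by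
  have h := Finset.sum_le_sum fun i (_ : i ∈ Finset.univ) => sub_le_mul_log_sub (ha i) (hb i)
  rw [Finset.sum_sub_distrib] at h
  linarith

/-- A weak form of Pinsker's inequality. -/
lemma pinsker {ι : Type*} [Fintype ι] {a b : ι → ℝ} (ha : ∀ i, 0 < a i) (hb : ∀ i, 0 < b i)
    (ha1 : ∑ i, a i = 1) (hb1 : ∑ i, b i = 1) :
    (∑ i, |a i - b i|) ^ 2 / 4 ≤ ∑ i, a i * (Real.log (a i) - Real.log (b i)) := by
  have h1 := Finset.sum_le_sum fun i (_ : i ∈ Finset.univ) =>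
    sq_sqrt_sub_le_mul_log_sub (ha i) (hb i)
  rw [Finset.sum_add_distrib, Finset.sum_sub_distrib, ha1, hb1] at h1
  have h2 : ∑ i, |a i - b i| = ∑ i, |√(a i) - √(b i)| * (√(a i) + √(b i)) := by
    refine Finset.sum_congr rfl fun i _ => ?_
    rw [← abs_of_nonneg (add_nonneg (Real.sqrt_nonneg (a i)) (Real.sqrt_nonneg (b i))), ← abs_mul]
    congr 1
    nlinarith [Real.sq_sqrt (ha i).le, Real.sq_sqrt (hb i).le]
  -- Cauchy–Schwarz on `|a - b| = |√a - √b| (√a + √b)`: the first factor gives the Hellinger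
  -- distance, the second at most 4. This costs a factor 2 against the sharp constant.
  have h3 := Finset.sum_mul_sq_le_sq_mul_sq Finset.univ
    (fun i => |√(a i) - √(b i)|) (fun i => √(a i) + √(b i))
  have h4 : ∑ i, (√(a i) + √(b i)) ^ 2 ≤ 4 := by
    have : ∑ i, (√(a i) + √(b i)) ^ 2 ≤ ∑ i, (2 * a i + 2 * b i) := by
      refine Finset.sum_le_sum fun i _ => ?_
      nlinarith [Real.sq_sqrt (ha i).le, Real.sq_sqrt (hb i).le, sq_nonneg (√(a i) - √(b i))]
    rw [Finset.sum_add_distrib, ← Finset.mul_sum, ← Finset.mul_sum, ha1, hb1] at this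
    linarith
  simp only [sq_abs] at h3
  rw [← h2] at h3
  have h5 : 0 ≤ ∑ i, (√(a i) - √(b i)) ^ 2 := Finset.sum_nonneg fun i _ => sq_nonneg _
  nlinarith

/-- Jensen's inequality for the square. -/
lemma sq_sum_weight_le {ι : Type*} [Fintype ι] {w : ι → ℝ} (hw : ∀ i, 0 ≤ w i)
    (hw1 : ∑ i, w i = 1) (x : ι → ℝ) : (∑ i, w i * x i) ^ 2 ≤ ∑ i, w i * x i ^ 2 := by
  simpa using (even_two.convexOn_pow (𝕜 := ℝ)).map_sum_le (t := Finset.univ) (w := w) (p := x)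
    (fun i _ => hw i) hw1 (fun i _ => Set.mem_univ _)

lemma sum_weight_le {ι : Type*} [Fintype ι] {w : ι → ℝ} (hw : ∀ i, 0 ≤ w i)
    (hw1 : ∑ i, w i = 1) {x : ι → ℝ} {b : ℝ} (hx : ∀ i, x i ≤ b) : ∑ i, w i * x i ≤ b := by
  calc ∑ i, w i * x i ≤ ∑ i, w i * b :=
        Finset.sum_le_sum fun i _ => mul_le_mul_of_nonneg_left (hx i) (hw i)
    _ = b := by rw [← Finset.sum_mul, hw1, one_mul]

lemma le_sum_weight {ι : Type*} [Fintype ι] {w : ι → ℝ} (hw : ∀ i, 0 ≤ w i)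
    (hw1 : ∑ i, w i = 1) {x : ι → ℝ} {b : ℝ} (hx : ∀ i, b ≤ x i) : b ≤ ∑ i, w i * x i := by
  calc b = ∑ i, w i * b := by rw [← Finset.sum_mul, hw1, one_mul]
    _ ≤ ∑ i, w i * x i :=
        Finset.sum_le_sum fun i _ => mul_le_mul_of_nonneg_left (hx i) (hw i)

/-! ## The dual of the entropic barycenter problem -/

variable {m n d k : ℕ}

/-- The plans `exp(-M^l_{ij} / η + u^l_i + v^l_j)`. -/
noncomputable def zeta (η : ℝ) (M : Fin m → Matrix (Fin n) (Fin n) ℝ) (u v : Fin m → Fin n → ℝ)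
    (l : Fin m) (i j : Fin n) : ℝ := Real.exp (u l i + v l j - M l i j / η)

/-- The column sums of a family of plans. -/
noncomputable def colSum (Z : Fin m → Fin n → Fin n → ℝ) (l : Fin m) (j : Fin n) : ℝ := ∑ i, Z l i j

/-- The averaged column sums of a family of plans. -/
noncomputable def Data.qbar (D : Data m n d) (Z : Fin m → Fin n → Fin n → ℝ) (j : Fin n) : ℝ :=
  ∑ l, D.weight l * colSum Z l j

/-- The averaged distance of the column sums from their average. -/
noncomputable def Data.err (D : Data m n d) (Z : Fin m → Fin n → Fin n → ℝ) : ℝ :=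
  ∑ l, D.weight l * ∑ j, |colSum Z l j - D.qbar Z j|

/-- The averaged `ℓ¹`-distance of two families of plans. -/
noncomputable def Data.dist (D : Data m n d) (Z Z' : Fin m → Fin n → Fin n → ℝ) : ℝ :=
  ∑ l, D.weight l * ∑ i, ∑ j, |Z l i j - Z' l i j|

/-- The averaged Kullback–Leibler divergence. -/
noncomputable def Data.kl (D : Data m n d) (Z Z' : Fin m → Fin n → Fin n → ℝ) : ℝ :=
  ∑ l, D.weight l * ∑ i, ∑ j, Z l i j * (Real.log (Z l i j) - Real.log (Z' l i j))

/-- The averaged transport cost. -/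
noncomputable def Data.pair (D : Data m n d) (Z : Fin m → Fin n → Fin n → ℝ)
    (M : Fin m → Matrix (Fin n) (Fin n) ℝ) : ℝ :=
  ∑ l, D.weight l * ∑ i, ∑ j, Z l i j * M l i j

/-- The dual objective, divided by `η`, at potentials for which the plans have total mass one. -/
noncomputable def Data.dual (D : Data m n d) (u : Fin m → Fin n → ℝ) : ℝ :=
  ∑ l, D.weight l * ∑ i, D.p l i * u l i

/-- Potentials for which the plans have the right row sums, which are dual feasible, and which have
bounded oscillation. -/
structure GoodState (D : Data m n d) (η c : ℝ) (M : Fin m → Matrix (Fin n) (Fin n) ℝ)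
    (s : (Fin m → Fin n → ℝ) × (Fin m → Fin n → ℝ)) : Prop where
  row : ∀ l i, ∑ j, zeta η M s.1 s.2 l i j = D.p l i
  bal : ∀ j, ∑ l, D.weight l * s.2 l j = 0
  osc : ∀ l, ∃ a, ∀ j, |s.2 l j - a| ≤ c / η

lemma zeta_pos (η : ℝ) (M : Fin m → Matrix (Fin n) (Fin n) ℝ) (u v : Fin m → Fin n → ℝ)
    (l : Fin m) (i j : Fin n) : 0 < zeta η M u v l i j := Real.exp_pos _

lemma sum_colSum (D : Data m n d) {Z : Fin m → Fin n → Fin n → ℝ}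
    (hZ : ∀ l i, ∑ j, Z l i j = D.p l i) (l : Fin m) : ∑ j, colSum Z l j = 1 := by
  simp only [colSum]
  rw [Finset.sum_comm, ← D.p_sum l]
  exact Finset.sum_congr rfl fun i _ => hZ l i

lemma sum_qbar (D : Data m n d) {Z : Fin m → Fin n → Fin n → ℝ}
    (hZ : ∀ l i, ∑ j, Z l i j = D.p l i) : ∑ j, D.qbar Z j = 1 := by
  simp only [Data.qbar]
  rw [Finset.sum_comm]
  simp only [← Finset.mul_sum, sum_colSum D hZ, mul_one, D.weight_sum]

lemma Data.err_nonneg (D : Data m n d) (Z : Fin m → Fin n → Fin n → ℝ) : 0 ≤ D.err Z :=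
  Finset.sum_nonneg fun l _ => mul_nonneg (D.weight_nonneg l)
    (Finset.sum_nonneg fun _ _ => abs_nonneg _)

lemma Data.dist_comm (D : Data m n d) (Z Z' : Fin m → Fin n → Fin n → ℝ) :
    D.dist Z Z' = D.dist Z' Z := by
  simp only [Data.dist, abs_sub_comm]

lemma Data.dist_triangle (D : Data m n d) (Z Z' Z'' : Fin m → Fin n → Fin n → ℝ) :
    D.dist Z Z'' ≤ D.dist Z Z' + D.dist Z' Z'' := by
  simp only [Data.dist, ← Finset.sum_add_distrib, ← mul_add]
  refine Finset.sum_le_sum fun l _ => mul_le_mul_of_nonneg_left ?_ (D.weight_nonneg l)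
  exact Finset.sum_le_sum fun i _ => Finset.sum_le_sum fun j _ => abs_sub_le _ _ _

lemma dist_sq_le_kl (D : Data m n d) {Z Z' : Fin m → Fin n → Fin n → ℝ}
    (hZ0 : ∀ l i j, 0 < Z l i j) (hZ0' : ∀ l i j, 0 < Z' l i j)
    (hZ : ∀ l i, ∑ j, Z l i j = D.p l i) (hZ' : ∀ l i, ∑ j, Z' l i j = D.p l i) :
    D.dist Z Z' ^ 2 / 4 ≤ D.kl Z Z' := by
  have h1 := sq_sum_weight_le D.weight_nonneg D.weight_sum
    fun l => ∑ i, ∑ j, |Z l i j - Z' l i j|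
  have h2 : ∑ l, D.weight l * (∑ i, ∑ j, |Z l i j - Z' l i j|) ^ 2 / 4 ≤ D.kl Z Z' := by
    refine Finset.sum_le_sum fun l _ => ?_
    rw [mul_div_assoc]
    refine mul_le_mul_of_nonneg_left ?_ (D.weight_nonneg l)
    have := pinsker (a := fun z : Fin n × Fin n => Z l z.1 z.2)
      (b := fun z : Fin n × Fin n => Z' l z.1 z.2) (fun z => hZ0 l _ _) (fun z => hZ0' l _ _)
      (by rw [Fintype.sum_prod_type]; simp only [hZ, D.p_sum])
      (by rw [Fintype.sum_prod_type]; simp only [hZ', D.p_sum])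
    simpa only [Fintype.sum_prod_type] using this
  rw [← Finset.sum_div] at h2
  simp only [Data.dist]
  linarith

/-- A sum against the deviations of the column sums is controlled by the oscillation. -/
lemma sum_mul_colSum_le (D : Data m n d) {Z : Fin m → Fin n → Fin n → ℝ}
    (hZ : ∀ l i, ∑ j, Z l i j = D.p l i) {w : Fin m → Fin n → ℝ} {b : ℝ}
    (hw : ∀ j, ∑ l, D.weight l * w l j = 0) (hb : ∀ l, ∃ a, ∀ j, |w l j - a| ≤ b) :
    ∑ l, D.weight l * ∑ j, w l j * colSum Z l j ≤ b * D.err Z := by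
  have h0 : ∑ l, D.weight l * ∑ j, w l j * D.qbar Z j = 0 := by
    simp only [Finset.mul_sum]
    rw [Finset.sum_comm]
    refine Finset.sum_eq_zero fun j _ => ?_
    rw [← zero_mul (D.qbar Z j), ← hw j, Finset.sum_mul]
    exact Finset.sum_congr rfl fun l _ => by ring
  rw [← sub_zero (∑ l, D.weight l * ∑ j, w l j * colSum Z l j), ← h0, ← Finset.sum_sub_distrib,
    Data.err, Finset.mul_sum]
  refine Finset.sum_le_sum fun l _ => ?_
  rw [← mul_sub, mul_left_comm]
  refine mul_le_mul_of_nonneg_left ?_ (D.weight_nonneg l)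
  obtain ⟨a, ha⟩ := hb l
  have h1 : ∑ j, w l j * colSum Z l j - ∑ j, w l j * D.qbar Z j
      = ∑ j, (w l j - a) * (colSum Z l j - D.qbar Z j) := by
    have : ∑ j, a * (colSum Z l j - D.qbar Z j) = 0 := by
      rw [← Finset.mul_sum, Finset.sum_sub_distrib, sum_colSum D hZ, sum_qbar D hZ]; simp
    rw [← Finset.sum_sub_distrib, ← sub_zero (∑ j, _), ← this, ← Finset.sum_sub_distrib]
    exact Finset.sum_congr rfl fun j _ => by ring
  rw [h1, Finset.mul_sum]
  refine Finset.sum_le_sum fun j _ => (le_abs_self _).trans ?_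
  rw [abs_mul]
  exact mul_le_mul_of_nonneg_right (ha j) (abs_nonneg _)

/-- The Kullback–Leibler divergence from a family of plans with the right row sums to the plans
of given potentials. -/
lemma kl_zeta (D : Data m n d) {η : ℝ} {M M' : Fin m → Matrix (Fin n) (Fin n) ℝ}
    {u v u' v' : Fin m → Fin n → ℝ}
    (hZ : ∀ l i, ∑ j, zeta η M' u' v' l i j = D.p l i) :
    D.kl (zeta η M' u' v') (zeta η M u v) =
      D.dual u' - D.dual u + ∑ l, D.weight l * ∑ j, (v' l j - v l j) * colSum (zeta η M' u' v') l j
        - (D.pair (zeta η M' u' v') M' - D.pair (zeta η M' u' v') M) / η := by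
  simp only [Data.kl, Data.dual, Data.pair, ← Finset.sum_sub_distrib, ← mul_sub, Finset.sum_div,
    mul_div_assoc, ← Finset.sum_add_distrib, ← mul_add]
  refine Finset.sum_congr rfl fun l _ => congrArg _ ?_
  have h1 : ∑ i, D.p l i * (u' l i - u l i)
      = ∑ i, ∑ j, zeta η M' u' v' l i j * (u' l i - u l i) := by
    refine Finset.sum_congr rfl fun i _ => ?_
    rw [← Finset.sum_mul, hZ]
  have h2 : ∑ j, (v' l j - v l j) * colSum (zeta η M' u' v') l j
      = ∑ i, ∑ j, zeta η M' u' v' l i j * (v' l j - v l j) := by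
    rw [Finset.sum_comm]
    refine Finset.sum_congr rfl fun j _ => ?_
    rw [colSum, ← Finset.sum_mul, mul_comm]
  rw [Finset.sum_sub_distrib, Finset.sum_add_distrib, h1, h2]
  simp only [← Finset.sum_sub_distrib, ← Finset.sum_add_distrib]
  refine Finset.sum_congr rfl fun i _ => Finset.sum_congr rfl fun j _ => ?_
  conv_lhs => rw [zeta, zeta, Real.log_exp, Real.log_exp]
  conv_rhs => rw [zeta]
  ring

/-- The basic comparison of two states, possibly for different costs. Both `v` lie within `c/η` of
constants, so their difference lies within `2c/η` of one. Only the column error of the primed state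
enters. -/
lemma dual_sub_dual_ge (D : Data m n d) {η c : ℝ} {M M' : Fin m → Matrix (Fin n) (Fin n) ℝ}
    {s s' : (Fin m → Fin n → ℝ) × (Fin m → Fin n → ℝ)}
    (hs : GoodState D η c M s) (hs' : GoodState D η c M' s') :
    (D.pair (zeta η M' s'.1 s'.2) M' - D.pair (zeta η M' s'.1 s'.2) M) / η
      + D.kl (zeta η M' s'.1 s'.2) (zeta η M s.1 s.2)
      - 2 * (c / η) * D.err (zeta η M' s'.1 s'.2) ≤ D.dual s'.1 - D.dual s.1 := by
  rw [kl_zeta D hs'.row]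
  have h := sum_mul_colSum_le D hs'.row (w := fun l j => s'.2 l j - s.2 l j) (b := 2 * (c / η))
    (fun j => by simp only [mul_sub, Finset.sum_sub_distrib, hs.bal, hs'.bal, sub_zero])
    (fun l => by
      obtain ⟨a, ha⟩ := hs.osc l
      obtain ⟨a', ha'⟩ := hs'.osc l
      refine ⟨a' - a, fun j => ?_⟩
      rw [show s'.2 l j - s.2 l j - (a' - a) = (s'.2 l j - a') - (s.2 l j - a) by ring]
      exact (abs_sub _ _).trans (by linarith [ha j, ha' j]))
  linarith

/-! ## One iteration of the iterative Bregman projections -/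

/-- The potentials `v` after an iteration. -/
noncomputable def Data.nextV (D : Data m n d) (η : ℝ) (M : Fin m → Matrix (Fin n) (Fin n) ℝ)
    (s : (Fin m → Fin n → ℝ) × (Fin m → Fin n → ℝ)) (l : Fin m) (j : Fin n) : ℝ :=
  s.2 l j + Real.log (Real.exp (∑ l', D.weight l' * Real.log (colSum (zeta η M s.1 s.2) l' j)) /
    colSum (zeta η M s.1 s.2) l j)

/-- The potentials after an iteration. -/
noncomputable def Data.next (D : Data m n d) (η : ℝ) (M : Fin m → Matrix (Fin n) (Fin n) ℝ)
    (s : (Fin m → Fin n → ℝ) × (Fin m → Fin n → ℝ)) :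
    (Fin m → Fin n → ℝ) × (Fin m → Fin n → ℝ) :=
  (fun l i => s.1 l i + Real.log (D.p l i / ∑ j, zeta η M s.1 (D.nextV η M s) l i j),
    D.nextV η M s)

lemma colSum_zeta_pos [NeZero n] (η : ℝ) (M : Fin m → Matrix (Fin n) (Fin n) ℝ)
    (u v : Fin m → Fin n → ℝ) (l : Fin m) (j : Fin n) : 0 < colSum (zeta η M u v) l j :=
  Finset.sum_pos (fun i _ => zeta_pos η M u v l i j) Finset.univ_nonempty

lemma rowSum_zeta_pos [NeZero n] (η : ℝ) (M : Fin m → Matrix (Fin n) (Fin n) ℝ)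
    (u v : Fin m → Fin n → ℝ) (l : Fin m) (i : Fin n) : 0 < ∑ j, zeta η M u v l i j :=
  Finset.sum_pos (fun j _ => zeta_pos η M u v l i j) Finset.univ_nonempty

lemma nextV_eq [NeZero n] (D : Data m n d) (η : ℝ) (M : Fin m → Matrix (Fin n) (Fin n) ℝ)
    (s : (Fin m → Fin n → ℝ) × (Fin m → Fin n → ℝ)) (l : Fin m) (j : Fin n) :
    D.nextV η M s l j = s.2 l j +
      (∑ l', D.weight l' * Real.log (colSum (zeta η M s.1 s.2) l' j)
        - Real.log (colSum (zeta η M s.1 s.2) l j)) := by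
  rw [Data.nextV, Real.log_div (Real.exp_ne_zero _) (colSum_zeta_pos η M s.1 s.2 l j).ne',
    Real.log_exp]

/-- As `0 ≤ M ≤ c`, the logarithm of a column sum is `v` plus a number independent of `j`, up to an
error in `[-c/η, 0]`. -/
lemma log_colSum_zeta [NeZero n] {η c : ℝ} (hη : 0 < η) {M : Fin m → Matrix (Fin n) (Fin n) ℝ}
    (hM0 : ∀ l i j, 0 ≤ M l i j) (hMc : ∀ l i j, M l i j ≤ c) (u v : Fin m → Fin n → ℝ)
    (l : Fin m) (j : Fin n) :
    v l j + Real.log (∑ i, Real.exp (u l i)) - c / η ≤ Real.log (colSum (zeta η M u v) l j) ∧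
      Real.log (colSum (zeta η M u v) l j) ≤ v l j + Real.log (∑ i, Real.exp (u l i)) := by
  have hS : 0 < ∑ i, Real.exp (u l i) :=
    Finset.sum_pos (fun i _ => Real.exp_pos _) Finset.univ_nonempty
  have hc := colSum_zeta_pos η M u v l j
  constructor
  · rw [Real.le_log_iff_exp_le hc, show v l j + Real.log (∑ i, Real.exp (u l i)) - c / η
      = (v l j - c / η) + Real.log (∑ i, Real.exp (u l i)) by ring, Real.exp_add,
      Real.exp_log hS, Finset.mul_sum]
    refine Finset.sum_le_sum fun i _ => ?_
    rw [← Real.exp_add, zeta, Real.exp_le_exp]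
    have := div_le_div_of_nonneg_right (hMc l i j) hη.le
    linarith
  · rw [Real.log_le_iff_le_exp hc, Real.exp_add, Real.exp_log hS, Finset.mul_sum]
    refine Finset.sum_le_sum fun i _ => ?_
    rw [← Real.exp_add, zeta, Real.exp_le_exp]
    have := div_nonneg (hM0 l i j) hη.le
    linarith

/-- In the `v`-step the old `v` cancels up to its weighted mean, which vanishes; hence the
oscillation bound holds after a single iteration from any balanced start. The `u`-step does not
touch `v`, and it normalizes the rows. -/
lemma goodState_next [NeZero n] (D : Data m n d) {η c : ℝ} (hη : 0 < η)
    {M : Fin m → Matrix (Fin n) (Fin n) ℝ} (hM0 : ∀ l i j, 0 ≤ M l i j)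
    (hMc : ∀ l i j, M l i j ≤ c) {s : (Fin m → Fin n → ℝ) × (Fin m → Fin n → ℝ)}
    (hs : ∀ j, ∑ l, D.weight l * s.2 l j = 0) : GoodState D η c M (D.next η M s) where
  row l i := by
    have hr := rowSum_zeta_pos η M s.1 (D.nextV η M s) l i
    have : ∀ j, zeta η M (D.next η M s).1 (D.next η M s).2 l i j
        = D.p l i / (∑ j, zeta η M s.1 (D.nextV η M s) l i j)
          * zeta η M s.1 (D.nextV η M s) l i j := by
      intro j
      rw [← Real.exp_log (div_pos (D.p_pos l i) hr)]
      conv_rhs => rw [zeta]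
      rw [← Real.exp_add, zeta]
      congr 1
      simp only [Data.next]
      ring
    simp only [this, ← Finset.mul_sum]
    exact div_mul_cancel₀ _ hr.ne'
  bal j := by
    simp only [Data.next, nextV_eq, mul_add, mul_sub, Finset.sum_add_distrib,
      Finset.sum_sub_distrib, hs, ← Finset.sum_mul, D.weight_sum]
    ring
  osc l := by
    refine ⟨∑ l', D.weight l' * Real.log (∑ i, Real.exp (s.1 l' i))
      - Real.log (∑ i, Real.exp (s.1 l i)), fun j => ?_⟩
    simp only [Data.next, nextV_eq]
    have h1 := fun l' => log_colSum_zeta hη hM0 hMc s.1 s.2 l' j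
    have h2 := sum_weight_le D.weight_nonneg D.weight_sum
      (x := fun l' => Real.log (colSum (zeta η M s.1 s.2) l' j)
        - s.2 l' j - Real.log (∑ i, Real.exp (s.1 l' i))) (b := 0)
      (fun l' => by linarith [(h1 l').2])
    have h3 := le_sum_weight D.weight_nonneg D.weight_sum
      (x := fun l' => Real.log (colSum (zeta η M s.1 s.2) l' j)
        - s.2 l' j - Real.log (∑ i, Real.exp (s.1 l' i))) (b := - (c / η))
      (fun l' => by linarith [(h1 l').1])
    simp only [mul_sub, Finset.sum_sub_distrib, hs] at h2 h3
    rw [abs_le]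
    constructor <;> linarith [(h1 l).1, (h1 l).2]

lemma goodState_iterate_next [NeZero n] (D : Data m n d) {η c : ℝ} (hη : 0 < η)
    {M : Fin m → Matrix (Fin n) (Fin n) ℝ} (hM0 : ∀ l i j, 0 ≤ M l i j)
    (hMc : ∀ l i j, M l i j ≤ c) {s : (Fin m → Fin n → ℝ) × (Fin m → Fin n → ℝ)}
    (hs : ∀ j, ∑ l, D.weight l * s.2 l j = 0) (N : ℕ) :
    GoodState D η c M ((D.next η M)^[N + 1] s) := by
  induction N with
  | zero => exact goodState_next D hη hM0 hMc hs
  | succ N ih =>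
    rw [Function.iterate_succ_apply']
    exact goodState_next D hη hM0 hMc ih.bal

/-- The gain of an iteration in the dual objective. -/
lemma err_sq_le_dual_next [NeZero n] (D : Data m n d) {η c : ℝ}
    {M : Fin m → Matrix (Fin n) (Fin n) ℝ}
    {s : (Fin m → Fin n → ℝ) × (Fin m → Fin n → ℝ)} (hs : GoodState D η c M s) :
    D.err (zeta η M s.1 s.2) ^ 2 / 16 ≤ D.dual (D.next η M s).1 - D.dual s.1 := by
  set q := colSum (zeta η M s.1 s.2) with hq
  have hq0 : ∀ l j, 0 < q l j := colSum_zeta_pos η M s.1 s.2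
  have hq1 : ∀ l, ∑ j, q l j = 1 := sum_colSum D hs.row
  set g : Fin n → ℝ := fun j => Real.exp (∑ l, D.weight l * Real.log (q l j)) with hg
  have hg0 : ∀ j, 0 < g j := fun j => Real.exp_pos _
  set G := ∑ j, g j with hG
  have hG0 : 0 < G := Finset.sum_pos (fun j _ => hg0 j) Finset.univ_nonempty
  set r : Fin m → Fin n → ℝ := fun l i => ∑ j, zeta η M s.1 (D.nextV η M s) l i j with hr
  have hr0 : ∀ l i, 0 < r l i := rowSum_zeta_pos η M s.1 _
  -- After the `v`-step every plan has column sums `g`, hence the same mass `G`.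
  have hr1 : ∀ l, ∑ i, r l i = G := by
    intro l
    simp only [hr, hG]
    rw [Finset.sum_comm]
    refine Finset.sum_congr rfl fun j _ => ?_
    have : ∀ i, zeta η M s.1 (D.nextV η M s) l i j
        = zeta η M s.1 s.2 l i j * (g j / q l j) := by
      intro i
      rw [← Real.exp_log (div_pos (hg0 j) (hq0 l j))]
      conv_rhs => rw [zeta]
      rw [← Real.exp_add, zeta]
      congr 1
      simp only [Data.nextV, hg, hq]
      ring
    simp only [this, ← Finset.sum_mul]
    exact mul_div_cancel₀ _ (hq0 l j).ne'
  -- The `u`-step gains the divergence of `p^l` from `r^l`. Gibbs for the normalized `r^l / G`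
  -- leaves `-log G`.
  have h1 : -Real.log G ≤ D.dual (D.next η M s).1 - D.dual s.1 := by
    have : D.dual (D.next η M s).1 - D.dual s.1
        = ∑ l, D.weight l * ∑ i, D.p l i * (Real.log (D.p l i) - Real.log (r l i)) := by
      simp only [Data.dual, ← Finset.sum_sub_distrib, ← mul_sub, Data.next]
      refine Finset.sum_congr rfl fun l _ => congrArg _ (Finset.sum_congr rfl fun i _ => ?_)
      rw [Real.log_div (D.p_pos l i).ne' (hr0 l i).ne']
      ring
    rw [this]
    refine le_sum_weight D.weight_nonneg D.weight_sum fun l => ?_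
    have h := gibbs (a := D.p l) (b := fun i => r l i / G) (fun i => (D.p_pos l i).le)
      (fun i => div_pos (hr0 l i) hG0) (by
        rw [← Finset.sum_div, hr1, div_self hG0.ne', D.p_sum])
    have h' : ∑ i, D.p l i * (Real.log (D.p l i) - Real.log (r l i / G))
        = ∑ i, D.p l i * (Real.log (D.p l i) - Real.log (r l i)) + Real.log G := by
      rw [← one_mul (Real.log G), ← D.p_sum l, Finset.sum_mul, ← Finset.sum_add_distrib]
      refine Finset.sum_congr rfl fun i _ => ?_
      rw [Real.log_div (hr0 l i).ne' hG0.ne']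
      ring
    linarith
  set h : Fin n → ℝ := fun j => g j / G with hh
  have hh0 : ∀ j, 0 < h j := fun j => div_pos (hg0 j) hG0
  have hh1 : ∑ j, h j = 1 := by simp only [hh, ← Finset.sum_div]; exact div_self hG0.ne'
  -- The normalized geometric mean `h` turns `-log G` into its averaged divergence from the `q^l`,
  -- to which Pinsker applies.
  have h2 : ∑ l, D.weight l * ∑ j, h j * (Real.log (h j) - Real.log (q l j)) = -Real.log G := by
    simp only [Finset.mul_sum]
    rw [Finset.sum_comm]
    have : ∀ j, ∑ l, D.weight l * (h j * (Real.log (h j) - Real.log (q l j)))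
        = h j * (-Real.log G) := by
      intro j
      have e1 : Real.log (h j) = ∑ l, D.weight l * Real.log (q l j) - Real.log G := by
        rw [hh]
        simp only
        rw [Real.log_div (hg0 j).ne' hG0.ne', hg, Real.log_exp]
      have e2 : ∑ l, D.weight l * (h j * (Real.log (h j) - Real.log (q l j)))
          = (∑ l, D.weight l) * (h j * Real.log (h j))
            - h j * ∑ l, D.weight l * Real.log (q l j) := by
        rw [Finset.sum_mul, Finset.mul_sum, ← Finset.sum_sub_distrib]
        exact Finset.sum_congr rfl fun l _ => by ring
      rw [e2, D.weight_sum, e1]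
      ring
    simp only [this, ← Finset.sum_mul, hh1, one_mul]
  have h3 : (∑ l, D.weight l * ∑ j, |h j - q l j|) ^ 2 / 4 ≤ -Real.log G := by
    rw [← h2]
    have := sq_sum_weight_le D.weight_nonneg D.weight_sum fun l => ∑ j, |h j - q l j|
    refine (div_le_div_of_nonneg_right this (by norm_num)).trans ?_
    rw [Finset.sum_div]
    refine Finset.sum_le_sum fun l _ => ?_
    rw [mul_div_assoc]
    exact mul_le_mul_of_nonneg_left (pinsker hh0 (hq0 l) hh1 (hq1 l)) (D.weight_nonneg l)
  -- Replacing the centre `h` by the mean `q̄` costs a factor 2, so `1/4` becomes `1/16`.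
  have h4 : D.err (zeta η M s.1 s.2) ≤ 2 * ∑ l, D.weight l * ∑ j, |h j - q l j| := by
    have e1 : ∑ j, |h j - D.qbar (zeta η M s.1 s.2) j| ≤ ∑ l, D.weight l * ∑ j, |h j - q l j| := by
      simp only [Finset.mul_sum]
      rw [Finset.sum_comm]
      refine Finset.sum_le_sum fun j _ => ?_
      have : h j - D.qbar (zeta η M s.1 s.2) j = ∑ l, D.weight l * (h j - q l j) := by
        simp only [mul_sub, Finset.sum_sub_distrib, ← Finset.sum_mul, D.weight_sum, one_mul,
          Data.qbar, hq]
      rw [this]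
      refine (Finset.abs_sum_le_sum_abs _ _).trans (Finset.sum_le_sum fun l _ => ?_)
      rw [abs_mul, abs_of_nonneg (D.weight_nonneg l)]
    have e2 : D.err (zeta η M s.1 s.2) ≤ ∑ l, D.weight l *
        (∑ j, |h j - q l j| + ∑ j, |h j - D.qbar (zeta η M s.1 s.2) j|) := by
      refine Finset.sum_le_sum fun l _ => mul_le_mul_of_nonneg_left ?_ (D.weight_nonneg l)
      rw [← Finset.sum_add_distrib]
      refine Finset.sum_le_sum fun j _ => ?_
      rw [abs_sub_comm (h j) (q l j)]
      exact abs_sub_le _ _ _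
    simp only [mul_add, Finset.sum_add_distrib, ← Finset.sum_mul, D.weight_sum, one_mul] at e2
    linarith
  have h5 := D.err_nonneg (zeta η M s.1 s.2)
  nlinarith

/-! ## The number of iterations -/

/-- Two regimes for the gap `a`. Eliminating `E` gives `a (s+1) ≤ a s - (β/α²) (a s)²`, so `a j ≤ α²
/ (β j)` after the first half. In the second half each step loses at least `β thr²`, so `a j ≥ j β
thr²`. Comparing at the midpoint gives the bound; `a 0` never appears. -/
lemma steps_le {a E : ℕ → ℝ} {α β thr : ℝ} (hα : 0 < α) (hβ : 0 < β) (hthr : 0 < thr) {j : ℕ}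
    (ha : 0 ≤ a (2 * j)) (hE : ∀ s < 2 * j, thr < E s)
    (h1 : ∀ s < 2 * j, a s ≤ α * E s) (h2 : ∀ s < 2 * j, β * E s ^ 2 ≤ a s - a (s + 1)) :
    (j : ℝ) * (β * thr) ≤ α := by
  have hlow : ∀ i ≤ 2 * j, (i : ℝ) * (β * thr ^ 2) ≤ a (2 * j - i) := by
    intro i
    induction i with
    | zero => simpa using ha
    | succ i ih =>
      intro hi
      have e := h2 (2 * j - (i + 1)) (by omega)
      rw [show 2 * j - (i + 1) + 1 = 2 * j - i by omega] at e
      have e2 := hE (2 * j - (i + 1)) (by omega)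
      have e3 := ih (by omega)
      have e4 : β * thr ^ 2 ≤ β * E (2 * j - (i + 1)) ^ 2 := by gcongr
      push_cast
      linarith
  have hpos : ∀ s ≤ 2 * j, 0 ≤ a s := by
    intro s hs
    have := hlow (2 * j - s) (by omega)
    rw [show 2 * j - (2 * j - s) = s by omega] at this
    exact le_trans (by positivity) this
  have hup : ∀ s ≤ 2 * j, (s : ℝ) * (β * a s) ≤ α ^ 2 := by
    intro s
    induction s with
    | zero => intro _; simp; positivity
    | succ s ih =>
      intro hs
      have e1 := ih (by omega)
      have e2 := h1 s (by omega)
      have e3 := h2 s (by omega)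
      have p0 := hpos s (by omega)
      have p1 := hpos (s + 1) hs
      have e4 : a s ^ 2 ≤ α ^ 2 * E s ^ 2 := by rw [← mul_pow]; gcongr
      -- Normalized gap: the recursion becomes `x ↦ x - x²`, which preserves the bound `s * x ≤ 1`
      -- when `s` grows by one.
      set x := β * a s / α ^ 2 with hx
      have hα2 : 0 < α ^ 2 := by positivity
      have hxa : β * a s = x * α ^ 2 := by rw [hx]; field_simp
      have hx0 : 0 ≤ x := by positivity
      have e5 : β * a (s + 1) ≤ (x - x ^ 2) * α ^ 2 := by
        have : β * (β * E s ^ 2) ≤ β * (a s - a (s + 1)) := by gcongr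
        have t : (β * a s) ^ 2 ≤ β ^ 2 * (α ^ 2 * E s ^ 2) := by
          rw [mul_pow]; gcongr
        rw [hxa] at t
        have t2 : x ^ 2 * α ^ 2 ≤ β ^ 2 * E s ^ 2 := by
          have : α ^ 2 * (x ^ 2 * α ^ 2) ≤ α ^ 2 * (β ^ 2 * E s ^ 2) := by nlinarith
          exact le_of_mul_le_mul_left this hα2
        nlinarith
      have e6 : (s : ℝ) * x ≤ 1 := by
        rw [hxa, ← mul_assoc] at e1
        exact le_of_mul_le_mul_right (by linarith) hα2
      have e7 : 0 ≤ x - x ^ 2 := by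
        have : 0 ≤ (x - x ^ 2) * α ^ 2 := le_trans (by positivity) e5
        exact nonneg_of_mul_nonneg_left this hα2
      have e8 : ((s : ℝ) + 1) * (x - x ^ 2) ≤ 1 := by
        rcases hx0.eq_or_lt with h | h
        · rw [← h]; norm_num
        · have hx1 : x ≤ 1 := by nlinarith
          nlinarith
      push_cast
      calc ((s : ℝ) + 1) * (β * a (s + 1)) ≤ (s + 1) * ((x - x ^ 2) * α ^ 2) := by gcongr
        _ = ((s + 1) * (x - x ^ 2)) * α ^ 2 := by ring
        _ ≤ 1 * α ^ 2 := by gcongr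
        _ = α ^ 2 := one_mul _
  have f1 := hlow j (by omega)
  rw [show 2 * j - j = j by omega] at f1
  have f2 := hup j (by omega)
  have f3 : ((j : ℝ) * (β * thr)) ^ 2 ≤ α ^ 2 := by
    calc ((j : ℝ) * (β * thr)) ^ 2 = j * (β * (j * (β * thr ^ 2))) := by ring
      _ ≤ j * (β * a j) := by gcongr
      _ ≤ α ^ 2 := f2
  exact (abs_le_of_sq_le_sq' f3 hα.le).2

/-- The iterative Bregman projections reach any accuracy, with an explicit bound for the number of
iterations that does not depend on the initial potentials. -/
lemma exists_err_le [NeZero n] (D : Data m n d) {η c thr : ℝ} (hη : 0 < η) (hc : 0 < c)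
    (hthr : 0 < thr) {M : Fin m → Matrix (Fin n) (Fin n) ℝ} (hM0 : ∀ l i j, 0 ≤ M l i j)
    (hMc : ∀ l i j, M l i j ≤ c) {s : (Fin m → Fin n → ℝ) × (Fin m → Fin n → ℝ)}
    (hs : ∀ j, ∑ l, D.weight l * s.2 l j = 0) :
    ∃ N : ℕ, (N : ℝ) ≤ 4 + 64 * c / (η * thr) ∧
      D.err (zeta η M ((D.next η M)^[N + 1] s).1 ((D.next η M)^[N + 1] s).2) ≤ thr := by
  by_contra! hcon
  have hgood := goodState_iterate_next D hη hM0 hMc hs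
  -- The shift by one discards the arbitrary start: only from the first iterate on is the state
  -- good.
  set S := fun N => (D.next η M)^[N + 1] s with hS
  set j := ⌊32 * c / (η * thr)⌋₊ + 1 with hj
  -- The gap is measured against the last iterate instead of an optimum, so it vanishes at `2 * j`
  -- and no maximizer is needed.
  have h := steps_le (a := fun t => D.dual (S (2 * j)).1 - D.dual (S t).1)
    (E := fun t => D.err (zeta η M (S t).1 (S t).2)) (α := 2 * (c / η)) (β := 1 / 16)
    (thr := thr) (j := j) (by positivity) (by norm_num) hthr (by simp)
    (fun t ht => by
      refine hcon t ?_
      have h1 : (t : ℝ) ≤ 2 * j := by exact_mod_cast ht.le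
      have h2 := Nat.floor_le (a := 32 * c / (η * thr)) (by positivity)
      have h3 : (j : ℝ) = (⌊32 * c / (η * thr)⌋₊ : ℝ) + 1 := by rw [hj]; push_cast; ring
      have h4 : 64 * c / (η * thr) = 2 * (32 * c / (η * thr)) := by ring
      linarith)
    (fun t ht => by
      have h1 := dual_sub_dual_ge D (hgood (2 * j)) (hgood t)
      have h2 : 0 ≤ D.kl (zeta η M (S t).1 (S t).2)
          (zeta η M (S (2 * j)).1 (S (2 * j)).2) :=
        le_trans (by positivity) (dist_sq_le_kl D (zeta_pos _ _ _ _) (zeta_pos _ _ _ _)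
          (hgood t).row (hgood (2 * j)).row)
      simp only [sub_self, zero_div, zero_add] at h1
      simp only [hS] at h2 ⊢
      linarith)
    (fun t ht => by
      have h1 := err_sq_le_dual_next D (hgood t)
      rw [← Function.iterate_succ_apply' (D.next η M)] at h1
      simp only [hS] at h1 ⊢
      linarith)
  have h2 := Nat.lt_floor_add_one (32 * c / (η * thr))
  have h3 : (j : ℝ) = (⌊32 * c / (η * thr)⌋₊ : ℝ) + 1 := by rw [hj]; push_cast; ring
  rw [← h3, div_lt_iff₀ (by positivity)] at h2
  have h5 : (j : ℝ) * (η * thr) ≤ 32 * c := by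
    have := mul_le_mul_of_nonneg_left h (by positivity : (0 : ℝ) ≤ 16 * η)
    have e : 16 * η * (2 * (c / η)) = 32 * c := by field_simp; norm_num
    linarith
  linarith

/-! ## Rounding -/

/-- Rounding a plan with the right row sums gives a plan with the prescribed marginals, at a
distance controlled by the error in the column sums. -/
lemma roundAlg_spec [NeZero n] {Z : Matrix (Fin n) (Fin n) ℝ} {p q : Fin n → ℝ}
    (hZ : ∀ i j, 0 < Z i j) (hp : ∀ i, 0 < p i) (hq : ∀ j, 0 ≤ q j)
    (hrow : ∀ i, ∑ j, Z i j = p i) (hpq : ∑ i, p i = ∑ j, q j) :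
    (∀ i j, 0 ≤ (roundAlg Z p q).val i j) ∧ (∀ i, ∑ j, (roundAlg Z p q).val i j = p i) ∧
      (∀ j, ∑ i, (roundAlg Z p q).val i j = q j) ∧
      ∑ i, ∑ j, |(roundAlg Z p q).val i j - Z i j| ≤ 2 * ∑ j, |∑ i, Z i j - q j| := by
  set c : Fin n → ℝ := fun j => ∑ i, Z i j with hc
  have hc0 : ∀ j, 0 < c j := fun j => Finset.sum_pos (fun i _ => hZ i j) Finset.univ_nonempty
  set y : Fin n → ℝ := fun j => min (q j / c j) 1 with hy
  have hy0 : ∀ j, 0 ≤ y j := fun j => le_min (div_nonneg (hq j) (hc0 j).le) zero_le_one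
  have hy1 : ∀ j, y j ≤ 1 := fun j => min_le_right _ _
  have hcy : ∀ j, c j * y j ≤ q j := fun j => by
    have := mul_le_mul_of_nonneg_left (min_le_left (q j / c j) 1) (hc0 j).le
    rwa [mul_div_cancel₀ _ (hc0 j).ne'] at this
  set ep : Fin n → ℝ := fun i => p i - ∑ j, Z i j * y j with hep
  set eq : Fin n → ℝ := fun j => q j - ∑ i, Z i j * y j with heq
  have heq' : ∀ j, eq j = q j - c j * y j := fun j => by simp only [heq, hc, Finset.sum_mul]
  have hep' : ∀ i, ep i = ∑ j, Z i j * (1 - y j) := fun i => by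
    simp only [hep, ← hrow i, mul_sub, mul_one, Finset.sum_sub_distrib]
  have hep0 : ∀ i, 0 ≤ ep i := fun i => by
    rw [hep']
    exact Finset.sum_nonneg fun j _ => mul_nonneg (hZ i j).le (by linarith [hy1 j])
  have heq0 : ∀ j, 0 ≤ eq j := fun j => by rw [heq']; linarith [hcy j]
  set S := ∑ i, ep i with hS
  have hSq : ∑ j, eq j = S := by
    simp only [hS, hep, heq, Finset.sum_sub_distrib, hpq]
    rw [Finset.sum_comm]
  have hval : ∀ i j, (roundAlg Z p q).val i j = Z i j * y j + ep i * eq j / S := by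
    intro i j
    -- The rows are already exact, so the row scaling does nothing and only columns are shrunk.
    have hx : ∀ i, min (p i / ∑ j, Z i j) 1 = 1 := fun i => by
      rw [hrow, div_self (hp i).ne', min_self]
    have h0 : (roundAlg Z p q).val i j =
      (min (p i / ∑ j, Z i j) 1 * Z i j) *
        min (q j / ∑ i, min (p i / ∑ j, Z i j) 1 * Z i j) 1 +
      (p i - ∑ j, (min (p i / ∑ j, Z i j) 1 * Z i j) *
        min (q j / ∑ i, min (p i / ∑ j, Z i j) 1 * Z i j) 1) *
      (q j - ∑ i, (min (p i / ∑ j, Z i j) 1 * Z i j) *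
        min (q j / ∑ i, min (p i / ∑ j, Z i j) 1 * Z i j) 1) /
      ∑ i, |p i - ∑ j, (min (p i / ∑ j, Z i j) 1 * Z i j) *
        min (q j / ∑ i, min (p i / ∑ j, Z i j) 1 * Z i j) 1| := rfl
    rw [h0]
    simp only [hx, one_mul]
    change Z i j * y j + ep i * eq j / ∑ i, |ep i| = _
    simp only [abs_of_nonneg (hep0 _), hS]
  have hS0 : 0 ≤ S := Finset.sum_nonneg fun i _ => hep0 i
  have hsum1 : ∀ i, ∑ j, ep i * eq j / S = ep i := by
    intro i
    rw [← Finset.sum_div, ← Finset.mul_sum, hSq]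
    -- If `S = 0`, all row errors vanish and division by zero yields 0, in agreement with the
    -- convention for the rank-one term.
    rcases hS0.eq_or_lt with h | h
    · rw [(Finset.sum_eq_zero_iff_of_nonneg fun i _ => hep0 i).1 h.symm i (Finset.mem_univ i)]
      simp
    · exact mul_div_cancel_right₀ _ h.ne'
  have hsum2 : ∀ j, ∑ i, ep i * eq j / S = eq j := by
    intro j
    rw [← Finset.sum_div, ← Finset.sum_mul, ← hS]
    rcases hS0.eq_or_lt with h | h
    · rw [(Finset.sum_eq_zero_iff_of_nonneg fun i _ => heq0 i).1 (hSq.trans h.symm) j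
        (Finset.mem_univ j)]
      simp
    · exact mul_div_cancel_left₀ _ h.ne'
  have hpos : ∀ i j, 0 ≤ ep i * eq j / S := fun i j =>
    div_nonneg (mul_nonneg (hep0 i) (heq0 j)) hS0
  have hSle : S ≤ ∑ j, |c j - q j| := by
    rw [← hSq]
    refine Finset.sum_le_sum fun j _ => ?_
    rw [heq']
    rcases le_total (q j / c j) 1 with h | h
    · have : c j * y j = q j := by
        simp only [hy, min_eq_left h]
        exact mul_div_cancel₀ _ (hc0 j).ne'
      rw [this, sub_self]
      exact abs_nonneg _
    · have : y j = 1 := min_eq_right h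
      rw [this, mul_one, abs_sub_comm]
      exact le_abs_self _
  refine ⟨fun i j => ?_, fun i => ?_, fun j => ?_, ?_⟩
  · rw [hval]
    exact add_nonneg (mul_nonneg (hZ i j).le (hy0 j)) (hpos i j)
  · simp only [hval, Finset.sum_add_distrib, hsum1]
    simp only [hep]
    ring
  · simp only [hval, Finset.sum_add_distrib, hsum2]
    simp only [heq]
    ring
  · calc ∑ i, ∑ j, |(roundAlg Z p q).val i j - Z i j|
        ≤ ∑ i, ∑ j, (ep i * eq j / S + Z i j * (1 - y j)) := by
          refine Finset.sum_le_sum fun i _ => Finset.sum_le_sum fun j _ => ?_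
          rw [hval, show Z i j * y j + ep i * eq j / S - Z i j
            = ep i * eq j / S - Z i j * (1 - y j) by ring]
          refine (abs_sub _ _).trans ?_
          rw [abs_of_nonneg (hpos i j),
            abs_of_nonneg (mul_nonneg (hZ i j).le (by linarith [hy1 j]))]
      -- The shrinking removes mass `S` and the rank-one term puts the same mass back.
      _ = 2 * S := by
          simp only [Finset.sum_add_distrib, hsum1, ← hep']
          rw [← hS]; ring
      _ ≤ _ := by linarith

/-- The plans returned by the subroutine in a given state. -/
noncomputable def Data.roundPlan (D : Data m n d) (η : ℝ) (M : Fin m → Matrix (Fin n) (Fin n) ℝ)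
    (s : (Fin m → Fin n → ℝ) × (Fin m → Fin n → ℝ)) : Fin m → Matrix (Fin n) (Fin n) ℝ :=
  fun l => (roundAlg (Matrix.of (zeta η M s.1 s.2 l)) (D.p l) (D.qbar (zeta η M s.1 s.2))).val

lemma roundPlan_spec [NeZero n] (D : Data m n d) {η c : ℝ}
    {M : Fin m → Matrix (Fin n) (Fin n) ℝ} {s : (Fin m → Fin n → ℝ) × (Fin m → Fin n → ℝ)}
    (hs : GoodState D η c M s) : D.roundPlan η M s ∈ D.couplings ∧
      D.dist (D.roundPlan η M s) (zeta η M s.1 s.2) ≤ 2 * D.err (zeta η M s.1 s.2) := by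
  have h := fun l => roundAlg_spec (Z := Matrix.of (zeta η M s.1 s.2 l)) (p := D.p l)
    (q := D.qbar (zeta η M s.1 s.2)) (zeta_pos η M s.1 s.2 l) (D.p_pos l)
    (fun j => Finset.sum_nonneg fun l _ => mul_nonneg (D.weight_nonneg l)
      (colSum_zeta_pos η M s.1 s.2 l j).le) (hs.row l)
    (by rw [D.p_sum, sum_qbar D hs.row])
  refine ⟨⟨fun l => (h l).1, fun l => (h l).2.1, fun l l' j => ?_⟩, ?_⟩
  · exact ((h l).2.2.1 j).trans ((h l').2.2.1 j).symm
  · unfold Data.dist Data.err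
    rw [Finset.mul_sum]
    refine Finset.sum_le_sum fun l _ => ?_
    rw [mul_left_comm]
    exact mul_le_mul_of_nonneg_left (h l).2.2.2 (D.weight_nonneg l)

lemma abs_pair_sub_le (D : Data m n d) {c : ℝ} {M : Fin m → Matrix (Fin n) (Fin n) ℝ}
    (hM : ∀ l i j, |M l i j| ≤ c) (Z Z' : Fin m → Fin n → Fin n → ℝ) :
    |D.pair Z M - D.pair Z' M| ≤ D.dist Z Z' * c := by
  rw [Data.pair, Data.pair, Data.dist, ← Finset.sum_sub_distrib, Finset.sum_mul]
  refine (Finset.abs_sum_le_sum_abs _ _).trans (Finset.sum_le_sum fun l _ => ?_)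
  rw [← mul_sub, abs_mul, abs_of_nonneg (D.weight_nonneg l), mul_assoc, ← Finset.sum_sub_distrib,
    Finset.sum_mul]
  refine mul_le_mul_of_nonneg_left ?_ (D.weight_nonneg l)
  refine (Finset.abs_sum_le_sum_abs _ _).trans (Finset.sum_le_sum fun i _ => ?_)
  rw [← Finset.sum_sub_distrib, Finset.sum_mul]
  refine (Finset.abs_sum_le_sum_abs _ _).trans (Finset.sum_le_sum fun j _ => ?_)
  rw [← sub_mul, abs_mul]
  exact mul_le_mul_of_nonneg_left (hM l i j) (abs_nonneg _)

lemma le_pair (D : Data m n d) {b : ℝ} {M : Fin m → Matrix (Fin n) (Fin n) ℝ}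
    (hM : ∀ l i j, b ≤ M l i j) {Z : Fin m → Fin n → Fin n → ℝ} (hZ0 : ∀ l i j, 0 ≤ Z l i j)
    (hZ : ∀ l i, ∑ j, Z l i j = D.p l i) : b ≤ D.pair Z M := by
  refine le_sum_weight D.weight_nonneg D.weight_sum fun l => ?_
  calc b = ∑ i, ∑ j, Z l i j * b := by simp only [← Finset.sum_mul, hZ, D.p_sum, one_mul]
    _ ≤ _ := Finset.sum_le_sum fun i _ => Finset.sum_le_sum fun j _ =>
      mul_le_mul_of_nonneg_left (hM l i j) (hZ0 l i j)

/-- The plans of a good state are nearly optimal for the unregularized problem. -/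
lemma pair_zeta_le [NeZero n] (D : Data m n d) {η c : ℝ} (hη : 0 < η)
    {M : Fin m → Matrix (Fin n) (Fin n) ℝ} {s : (Fin m → Fin n → ℝ) × (Fin m → Fin n → ℝ)}
    (hs : GoodState D η c M s) {π : Fin m → Matrix (Fin n) (Fin n) ℝ} (hπ : π ∈ D.couplings) :
    D.pair (zeta η M s.1 s.2) M - D.pair π M
      ≤ 2 * η * Real.log n + c * D.err (zeta η M s.1 s.2) := by
  set Z := zeta η M s.1 s.2 with hZ
  obtain ⟨hπ0, hπr, hπc⟩ := hπ
  have key : ∀ (P : Fin m → Fin n → Fin n → ℝ), (∀ l i, ∑ j, P l i j = D.p l i) → ∀ l,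
      ∑ i, ∑ j, P l i j * Real.log (Z l i j) = ∑ i, D.p l i * s.1 l i
        + ∑ j, s.2 l j * colSum P l j - (∑ i, ∑ j, P l i j * M l i j) / η := by
    intro P hP l
    have h1 : ∑ i, D.p l i * s.1 l i = ∑ i, ∑ j, P l i j * s.1 l i := by
      simp only [← Finset.sum_mul, hP]
    have h2 : ∑ j, s.2 l j * colSum P l j = ∑ i, ∑ j, P l i j * s.2 l j := by
      rw [Finset.sum_comm]
      simp only [← Finset.sum_mul, colSum, mul_comm]
    rw [h1, h2]
    simp only [Finset.sum_div, ← Finset.sum_add_distrib, ← Finset.sum_sub_distrib]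
    refine Finset.sum_congr rfl fun i _ => Finset.sum_congr rfl fun j _ => ?_
    rw [hZ, zeta, Real.log_exp]
    ring
  -- Weak duality: Gibbs for `π` against `Z`, with `∑ π log π ≤ 0` dropped. The `v`-terms cancel
  -- because `v` is balanced and `π` has common column sums.
  have h1 : D.dual s.1 ≤ D.pair π M / η := by
    have e1 : ∀ l, ∑ i, D.p l i * s.1 l i + ∑ j, s.2 l j * colSum (fun l => π l) l j
        ≤ (∑ i, ∑ j, π l i j * M l i j) / η := by
      intro l
      have h := gibbs (a := fun z : Fin n × Fin n => π l z.1 z.2)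
        (b := fun z : Fin n × Fin n => Z l z.1 z.2) (fun z => hπ0 l _ _)
        (fun z => zeta_pos η M s.1 s.2 l _ _)
        (by rw [Fintype.sum_prod_type, Fintype.sum_prod_type]; simp only [hπr, hs.row, hZ, le_refl])
      simp only [Fintype.sum_prod_type, mul_sub, Finset.sum_sub_distrib] at h
      rw [key (fun l => π l) hπr l] at h
      have h' : ∑ i, ∑ j, π l i j * Real.log (π l i j) ≤ 0 := by
        refine Finset.sum_nonpos fun i _ => Finset.sum_nonpos fun j _ => ?_
        refine mul_nonpos_of_nonneg_of_nonpos (hπ0 l i j) (Real.log_nonpos (hπ0 l i j) ?_)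
        calc π l i j ≤ ∑ j, π l i j :=
              Finset.single_le_sum (fun j _ => hπ0 l i j) (Finset.mem_univ j)
          _ = D.p l i := hπr l i
          _ ≤ ∑ i, D.p l i :=
              Finset.single_le_sum (fun i _ => (D.p_pos l i).le) (Finset.mem_univ i)
          _ = 1 := D.p_sum l
      linarith
    have e2 : ∑ l, D.weight l * ∑ j, s.2 l j * colSum (fun l => π l) l j = 0 := by
      rcases isEmpty_or_nonempty (Fin m) with hm | ⟨⟨l₀⟩⟩
      · simp
      · have : ∀ l j, colSum (fun l => π l) l j = colSum (fun l => π l) l₀ j :=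
          fun l j => hπc l l₀ j
        simp only [this, Finset.mul_sum]
        rw [Finset.sum_comm]
        refine Finset.sum_eq_zero fun j _ => ?_
        simp only [← mul_assoc, ← Finset.sum_mul, hs.bal, zero_mul]
    have e3 := Finset.sum_le_sum fun l (_ : l ∈ Finset.univ) =>
      mul_le_mul_of_nonneg_left (e1 l) (D.weight_nonneg l)
    simp only [mul_add, Finset.sum_add_distrib, e2, add_zero] at e3
    refine e3.trans (le_of_eq ?_)
    unfold Data.pair
    rw [Finset.sum_div]
    exact Finset.sum_congr rfl fun l _ => (mul_div_assoc _ _ _).symm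
  -- Gibbs against the uniform plan on `n²` points bounds the entropy of `Z` by `2 log n`. The
  -- `v`-terms now leave the column error.
  have h2 : D.pair Z M / η ≤ 2 * Real.log n + D.dual s.1 + c / η * D.err Z := by
    have e1 : ∀ l, (∑ i, ∑ j, Z l i j * M l i j) / η
        ≤ 2 * Real.log n + (∑ i, D.p l i * s.1 l i + ∑ j, s.2 l j * colSum Z l j) := by
      intro l
      have hn : (0 : ℝ) < n := by exact_mod_cast NeZero.pos n
      have h := gibbs (a := fun z : Fin n × Fin n => Z l z.1 z.2)
        (b := fun z : Fin n × Fin n => ((n : ℝ) ^ 2)⁻¹) (fun z => (zeta_pos η M s.1 s.2 l _ _).le)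
        (fun z => by positivity)
        (by
          rw [Fintype.sum_prod_type, Fintype.sum_prod_type]
          simp only [hs.row, hZ, D.p_sum, Finset.sum_const, Finset.card_univ, Fintype.card_fin,
            nsmul_eq_mul]
          refine le_of_eq ?_
          field_simp)
      simp only [Fintype.sum_prod_type, mul_sub, Finset.sum_sub_distrib] at h
      rw [key Z hs.row l, Real.log_inv, Real.log_pow] at h
      simp only [← Finset.sum_mul] at h
      have : ∑ i, ∑ j, Z l i j = 1 := by
        simp only [hZ, hs.row, D.p_sum]
      rw [this] at h
      push_cast at h
      linarith
    have e2 := sum_mul_colSum_le D hs.row hs.bal hs.osc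
    have e3 := Finset.sum_le_sum fun l (_ : l ∈ Finset.univ) =>
      mul_le_mul_of_nonneg_left (e1 l) (D.weight_nonneg l)
    simp only [mul_add, Finset.sum_add_distrib, ← Finset.sum_mul, D.weight_sum, one_mul] at e3
    have e4 : D.pair Z M / η = ∑ l, D.weight l * ((∑ i, ∑ j, Z l i j * M l i j) / η) := by
      rw [Data.pair, Finset.sum_div]
      exact Finset.sum_congr rfl fun l _ => (mul_div_assoc _ _ _)
    rw [e4]
    simp only [Data.dual]
    linarith
  have h3 := mul_le_mul_of_nonneg_left (h2.trans (by linarith :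
    _ ≤ 2 * Real.log n + D.pair π M / η + c / η * D.err Z)) hη.le
  have h4 : η * (D.pair Z M / η) = D.pair Z M := mul_div_cancel₀ _ hη.ne'
  have h5 : η * (2 * Real.log n + D.pair π M / η + c / η * D.err Z)
      = 2 * η * Real.log n + D.pair π M + c * D.err Z := by field_simp
  linarith

/-! ## Frobenius norms and tangent spaces -/

lemma frobenius_sq (X : Matrix (Fin d) (Fin k) ℝ) : ‖X‖ ^ 2 = ∑ a, ∑ b, X a b ^ 2 := by
  have h0 : 0 ≤ ∑ a, ∑ b, X a b ^ 2 :=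
    Finset.sum_nonneg fun a _ => Finset.sum_nonneg fun b _ => sq_nonneg _
  rw [Matrix.frobenius_norm_def]
  simp only [Real.norm_eq_abs, Real.rpow_ofNat, sq_abs]
  rw [← Real.sqrt_eq_rpow, Real.sq_sqrt h0]

lemma sum_mul_eq_trace (X Y : Matrix (Fin d) (Fin k) ℝ) :
    ∑ a, ∑ b, X a b * Y a b = (Xᵀ * Y).trace := by
  simp only [Matrix.trace, Matrix.diag_apply, Matrix.mul_apply, Matrix.transpose_apply]
  exact Finset.sum_comm

lemma sum_sq_mul_le (X : Matrix (Fin d) (Fin k) ℝ) (z : Fin d → ℝ) :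
    ∑ b, (∑ a, X a b * z a) ^ 2 ≤ ‖X‖ ^ 2 * ∑ a, z a ^ 2 := by
  rw [frobenius_sq, Finset.sum_comm, Finset.sum_mul]
  exact Finset.sum_le_sum fun b _ => Finset.sum_mul_sq_le_sq_mul_sq _ _ _

/-- Bessel's inequality. -/
lemma sum_sq_mul_le_of_mem_stiefel {U : Matrix (Fin d) (Fin k) ℝ} (hU : U ∈ Stiefel d k)
    (z : Fin d → ℝ) : ∑ b, (∑ a, U a b * z a) ^ 2 ≤ ∑ a, z a ^ 2 := by
  have hU' : Uᵀ * U = 1 := hU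
  set w : Fin k → ℝ := Uᵀ *ᵥ z with hw
  have h1 : ∑ b, (∑ a, U a b * z a) ^ 2 = w ⬝ᵥ w := by
    simp only [dotProduct, hw, Matrix.mulVec, Matrix.transpose_apply, sq]
  have h2 : ∑ a, z a ^ 2 = z ⬝ᵥ z := by simp only [dotProduct, sq]
  have h3 : 0 ≤ (z - U *ᵥ w) ⬝ᵥ (z - U *ᵥ w) :=
    Finset.sum_nonneg fun a _ => mul_self_nonneg _
  have h4 : z ⬝ᵥ (U *ᵥ w) = w ⬝ᵥ w := by
    rw [Matrix.dotProduct_mulVec, ← Matrix.mulVec_transpose]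
  have h5 : (U *ᵥ w) ⬝ᵥ (U *ᵥ w) = w ⬝ᵥ w := by
    rw [Matrix.dotProduct_mulVec, ← Matrix.mulVec_transpose, Matrix.mulVec_mulVec, hU',
      Matrix.one_mulVec]
  rw [sub_dotProduct, dotProduct_sub, dotProduct_sub, h5, dotProduct_comm (U *ᵥ w) z, h4] at h3
  rw [h1, h2]
  linarith

lemma smul_mem_tangentSpace {U ξ : Matrix (Fin d) (Fin k) ℝ} (hξ : ξ ∈ tangentSpace U) (t : ℝ) :
    t • ξ ∈ tangentSpace U := by
  have hξ' : Uᵀ * ξ + ξᵀ * U = 0 := hξ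
  change Uᵀ * (t • ξ) + (t • ξ)ᵀ * U = 0
  rw [Matrix.transpose_smul, Matrix.mul_smul, Matrix.smul_mul, ← smul_add, hξ', smul_zero]

lemma tangentProj_mem {U : Matrix (Fin d) (Fin k) ℝ} (hU : U ∈ Stiefel d k)
    (G : Matrix (Fin d) (Fin k) ℝ) : tangentProj U G ∈ tangentSpace U := by
  have hU' : Uᵀ * U = 1 := hU
  set S : Matrix (Fin k) (Fin k) ℝ := (1 / 2 : ℝ) • (Uᵀ * G + Gᵀ * U) with hS
  have hST : Sᵀ = S := by
    rw [hS, Matrix.transpose_smul, Matrix.transpose_add, Matrix.transpose_mul,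
      Matrix.transpose_mul, Matrix.transpose_transpose, Matrix.transpose_transpose, add_comm]
  change Uᵀ * (G - U * S) + (G - U * S)ᵀ * U = 0
  rw [Matrix.mul_sub, ← Matrix.mul_assoc, hU', Matrix.one_mul, Matrix.transpose_sub,
    Matrix.transpose_mul, Matrix.sub_mul, Matrix.mul_assoc, hU', Matrix.mul_one, hST,
    show Uᵀ * G - S + (Gᵀ * U - S) = (Uᵀ * G + Gᵀ * U) - (2 : ℝ) • S by rw [two_smul]; abel, hS,
    smul_smul]
  norm_num

/-- `G - ξ = U S` with `S` symmetric, while `Uᵀ ξ` is skew, so the trace pairing of the two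
vanishes. This makes the directional derivative along `ξ` equal to `‖ξ‖²`. -/
lemma sum_mul_tangentProj {U : Matrix (Fin d) (Fin k) ℝ} (hU : U ∈ Stiefel d k)
    (G : Matrix (Fin d) (Fin k) ℝ) :
    ∑ a, ∑ b, G a b * tangentProj U G a b = ‖tangentProj U G‖ ^ 2 := by
  set S : Matrix (Fin k) (Fin k) ℝ := (1 / 2 : ℝ) • (Uᵀ * G + Gᵀ * U) with hS
  have hST : Sᵀ = S := by
    rw [hS, Matrix.transpose_smul, Matrix.transpose_add, Matrix.transpose_mul,
      Matrix.transpose_mul, Matrix.transpose_transpose, Matrix.transpose_transpose, add_comm]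
  set ξ := tangentProj U G with hξ
  have hG : G = ξ + U * S := by rw [hξ, tangentProj, ← hS]; abel
  have hT : Uᵀ * ξ + ξᵀ * U = 0 := tangentProj_mem hU G
  have h0 : (S * (Uᵀ * ξ)).trace = 0 := by
    have e : (S * (Uᵀ * ξ)).trace = (S * (ξᵀ * U)).trace := by
      rw [← Matrix.trace_transpose, Matrix.transpose_mul, hST, Matrix.transpose_mul,
        Matrix.transpose_transpose, Matrix.trace_mul_comm]
    have e2 : (S * (Uᵀ * ξ)).trace + (S * (ξᵀ * U)).trace = 0 := by
      rw [← Matrix.trace_add, ← Matrix.mul_add, hT, Matrix.mul_zero, Matrix.trace_zero]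
    linarith
  rw [sum_mul_eq_trace, frobenius_sq]
  simp only [sq]
  rw [sum_mul_eq_trace]
  conv_lhs => rw [hG]
  rw [Matrix.transpose_add, Matrix.add_mul, Matrix.trace_add, Matrix.transpose_mul, hST,
    Matrix.mul_assoc, h0, add_zero]

/-! ## Projected costs -/

lemma cost_le_cbar (D : Data m n d) (l : Fin m) (i j : Fin n) : D.cost l i j ≤ D.cbar :=
  le_ciSup (f := fun z : Fin m × Fin n × Fin n => D.cost z.1 z.2.1 z.2.2)
    (Set.finite_range _).bddAbove (l, i, j)

/-- The matrices of projected costs. -/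
noncomputable def Data.costMat (D : Data m n d) (U : Matrix (Fin d) (Fin k) ℝ) :
    Fin m → Matrix (Fin n) (Fin n) ℝ := fun l => Matrix.of (D.projCost U l)

/-- The bilinear form `⟨Uᵀ (x^l_i - y_j), ξᵀ (x^l_i - y_j)⟩`. -/
noncomputable def Data.biMat (D : Data m n d) (U ξ : Matrix (Fin d) (Fin k) ℝ) :
    Fin m → Matrix (Fin n) (Fin n) ℝ := fun l => Matrix.of fun i j =>
  ∑ b, (∑ a, U a b * (D.x l i a - D.y j a)) * ∑ a, ξ a b * (D.x l i a - D.y j a)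

lemma projCost_nonneg (D : Data m n d) (U : Matrix (Fin d) (Fin k) ℝ) (l : Fin m) (i j : Fin n) :
    0 ≤ D.projCost U l i j := Finset.sum_nonneg fun _ _ => sq_nonneg _

lemma projCost_le (D : Data m n d) {U : Matrix (Fin d) (Fin k) ℝ} (hU : U ∈ Stiefel d k)
    (l : Fin m) (i j : Fin n) : D.projCost U l i j ≤ D.cbar :=
  (sum_sq_mul_le_of_mem_stiefel hU _).trans (cost_le_cbar D l i j)

lemma projCost_le_norm (D : Data m n d) (X : Matrix (Fin d) (Fin k) ℝ)
    (l : Fin m) (i j : Fin n) : D.projCost X l i j ≤ ‖X‖ ^ 2 * D.cbar :=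
  (sum_sq_mul_le X _).trans (mul_le_mul_of_nonneg_left (cost_le_cbar D l i j) (sq_nonneg _))

/-- Cauchy–Schwarz, with Bessel's inequality for the factor with `U` and the Frobenius norm for the
factor with `ξ`. -/
lemma abs_biMat_le (D : Data m n d) {U : Matrix (Fin d) (Fin k) ℝ} (hU : U ∈ Stiefel d k)
    (hc : 0 ≤ D.cbar) (ξ : Matrix (Fin d) (Fin k) ℝ) (l : Fin m) (i j : Fin n) :
    |D.biMat U ξ l i j| ≤ D.cbar * ‖ξ‖ := by
  refine abs_le_of_sq_le_sq ?_ (mul_nonneg hc (norm_nonneg _))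
  refine (Finset.sum_mul_sq_le_sq_mul_sq Finset.univ
    (fun b => ∑ a, U a b * (D.x l i a - D.y j a))
    (fun b => ∑ a, ξ a b * (D.x l i a - D.y j a))).trans ?_
  calc _ ≤ D.cbar * (‖ξ‖ ^ 2 * D.cbar) :=
        mul_le_mul (projCost_le D hU l i j) (projCost_le_norm D ξ l i j)
          (Finset.sum_nonneg fun _ _ => sq_nonneg _) hc
    _ = _ := by ring

/-- The cost is quadratic in `U`, so the expansion is exact. Its second-order part is nonnegative
and may be dropped in the ascent. -/
lemma projCost_sub (D : Data m n d) (U V : Matrix (Fin d) (Fin k) ℝ) (l : Fin m) (i j : Fin n) :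
    D.projCost V l i j - D.projCost U l i j
      = 2 * D.biMat U (V - U) l i j + D.projCost (V - U) l i j := by
  simp only [Data.projCost, Data.biMat, Matrix.of_apply, Matrix.sub_apply, sub_mul,
    Finset.sum_sub_distrib, Finset.mul_sum, ← Finset.sum_add_distrib]
  rw [← Finset.sum_sub_distrib]
  exact Finset.sum_congr rfl fun b _ => by ring

/-- Factor the difference of squares. With both matrices on the manifold, each factor is controlled
by `abs_biMat_le` and no quadratic term appears. -/
lemma abs_projCost_sub_le (D : Data m n d) {U V : Matrix (Fin d) (Fin k) ℝ}
    (hU : U ∈ Stiefel d k) (hV : V ∈ Stiefel d k) (hc : 0 ≤ D.cbar) (l : Fin m) (i j : Fin n) :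
    |D.projCost V l i j - D.projCost U l i j| ≤ 2 * D.cbar * ‖V - U‖ := by
  have e1 : D.projCost V l i j - D.projCost U l i j
      = D.biMat U (V - U) l i j + D.biMat V (V - U) l i j := by
    simp only [Data.projCost, Data.biMat, Matrix.of_apply, Matrix.sub_apply, sub_mul,
      Finset.sum_sub_distrib]
    rw [← Finset.sum_sub_distrib, ← Finset.sum_add_distrib]
    exact Finset.sum_congr rfl fun b _ => by ring
  rw [e1]
  refine (abs_add_le _ _).trans ?_
  linarith [abs_biMat_le D hU hc (V - U) l i j, abs_biMat_le D hV hc (V - U) l i j]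

lemma biMat_add (D : Data m n d) (U ξ ξ' : Matrix (Fin d) (Fin k) ℝ) (l : Fin m) (i j : Fin n) :
    D.biMat U (ξ + ξ') l i j = D.biMat U ξ l i j + D.biMat U ξ' l i j := by
  simp only [Data.biMat, Matrix.of_apply, Matrix.add_apply, add_mul, Finset.sum_add_distrib,
    mul_add]

lemma biMat_smul (D : Data m n d) (U ξ : Matrix (Fin d) (Fin k) ℝ) (t : ℝ) (l : Fin m)
    (i j : Fin n) : D.biMat U (t • ξ) l i j = t * D.biMat U ξ l i j := by
  simp only [Data.biMat, Matrix.of_apply, Matrix.smul_apply, smul_eq_mul, mul_assoc,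
    Finset.mul_sum, mul_left_comm]

lemma pair_sub_pair (D : Data m n d) (Z : Fin m → Fin n → Fin n → ℝ)
    (M M' : Fin m → Matrix (Fin n) (Fin n) ℝ) :
    D.pair Z M - D.pair Z M' = D.pair Z (fun l => M l - M' l) := by
  simp only [Data.pair, Matrix.sub_apply, mul_sub, Finset.sum_sub_distrib]

lemma pair_mul (D : Data m n d) (Z : Fin m → Fin n → Fin n → ℝ) (t : ℝ)
    (M : Fin m → Matrix (Fin n) (Fin n) ℝ) :
    D.pair Z (fun l => t • M l) = t * D.pair Z M := by
  simp only [Data.pair, Matrix.smul_apply, smul_eq_mul, Finset.mul_sum, mul_left_comm]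

/-! ## The gradient -/

lemma gradAlg_val (D : Data m n d) (π : Fin m → Matrix (Fin n) (Fin n) ℝ)
    (U : Matrix (Fin d) (Fin k) ℝ) (a : Fin d) (b : Fin k) :
    (gradAlg D π U).val a b = 2 * ∑ l, D.weight l * ∑ i, ∑ j, π l i j *
      ((D.x l i a - D.y j a) * ∑ a, (D.x l i a - D.y j a) * U a b) := rfl

lemma sum_gradAlg_mul (D : Data m n d) (π : Fin m → Matrix (Fin n) (Fin n) ℝ)
    (U ξ : Matrix (Fin d) (Fin k) ℝ) :
    ∑ a, ∑ b, (gradAlg D π U).val a b * ξ a b = 2 * D.pair π (D.biMat U ξ) := by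
  have h : ∀ l i j, D.biMat U ξ l i j = ∑ a, ∑ b,
      ((D.x l i a - D.y j a) * ∑ a, (D.x l i a - D.y j a) * U a b) * ξ a b := by
    intro l i j
    rw [Data.biMat, Matrix.of_apply, Finset.sum_comm]
    refine Finset.sum_congr rfl fun b _ => ?_
    rw [Finset.mul_sum]
    refine Finset.sum_congr rfl fun a _ => ?_
    rw [show ∑ a, U a b * (D.x l i a - D.y j a) = ∑ a, (D.x l i a - D.y j a) * U a b from
      Finset.sum_congr rfl fun a _ => mul_comm _ _]
    ring
  have h2 : ∀ (c : Fin m → Fin n × Fin n → Fin d × Fin k → ℝ) (P : Fin m → Fin n × Fin n → ℝ)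
      (X : Fin d × Fin k → ℝ), ∑ z, (2 * ∑ l, D.weight l * ∑ y, P l y * c l y z) * X z
        = 2 * ∑ l, D.weight l * ∑ y, P l y * ∑ z, c l y z * X z := by
    intro c P X
    simp only [Finset.sum_mul, Finset.mul_sum]
    rw [Finset.sum_comm]
    refine Finset.sum_congr rfl fun l _ => ?_
    rw [Finset.sum_comm]
    exact Finset.sum_congr rfl fun y _ => Finset.sum_congr rfl fun z _ => by ring
  have h3 := h2 (fun l y z => (D.x l y.1 z.1 - D.y y.2 z.1) *
    ∑ a, (D.x l y.1 a - D.y y.2 a) * U a z.2) (fun l y => π l y.1 y.2) (fun z => ξ z.1 z.2)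
  simp only [Fintype.sum_prod_type] at h3
  simp only [gradAlg_val, Data.pair, h]
  exact h3

lemma euclideanGrad_f (D : Data m n d) (π : Fin m → Matrix (Fin n) (Fin n) ℝ)
    (U : Matrix (Fin d) (Fin k) ℝ) : euclideanGrad (D.f π) U = (gradAlg D π U).val := by
  ext a b
  rw [gradAlg_val, euclideanGrad, Matrix.of_apply]
  have h1 : ∀ l i j, HasDerivAt
      (fun s : ℝ => D.projCost (U + s • Matrix.single a b 1) l i j)
      (2 * ((D.x l i a - D.y j a) * ∑ a, (D.x l i a - D.y j a) * U a b)) 0 := by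
    intro l i j
    have e : ∀ (s : ℝ) (b' : Fin k), ∑ a', (U + s • Matrix.single a b (1 : ℝ)) a' b' *
        (D.x l i a' - D.y j a') = ∑ a', U a' b' * (D.x l i a' - D.y j a')
          + s * (if b = b' then D.x l i a - D.y j a else 0) := by
      intro s b'
      simp only [Matrix.add_apply, Matrix.smul_apply, Matrix.single_apply, smul_eq_mul, add_mul,
        Finset.sum_add_distrib]
      congr 1
      rw [Finset.sum_eq_single a (fun a' _ h => by simp [Ne.symm h]) (by simp)]
      by_cases h : b = b' <;> simp [h]
    simp only [Data.projCost, e]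
    have h2 : ∀ b' ∈ (Finset.univ : Finset (Fin k)), HasDerivAt (fun s : ℝ =>
        (∑ a', U a' b' * (D.x l i a' - D.y j a')
          + s * (if b = b' then D.x l i a - D.y j a else 0)) ^ 2)
        (2 * (∑ a', U a' b' * (D.x l i a' - D.y j a')) *
          (if b = b' then D.x l i a - D.y j a else 0)) 0 := by
      intro b' _
      have := (((hasDerivAt_id (0 : ℝ)).mul_const
        (if b = b' then D.x l i a - D.y j a else 0)).const_add
          (∑ a', U a' b' * (D.x l i a' - D.y j a'))).pow 2
      simpa [Pi.pow_def] using this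
    have h3 := HasDerivAt.fun_sum h2
    refine h3.congr_deriv ?_
    simp only [mul_ite, mul_zero, Finset.sum_ite_eq, Finset.mem_univ, if_true]
    rw [show ∑ a, U a b * (D.x l i a - D.y j a) = ∑ a, (D.x l i a - D.y j a) * U a b from
      Finset.sum_congr rfl fun a _ => mul_comm _ _]
    ring
  have h2 : HasDerivAt (fun s : ℝ => D.f π (U + s • Matrix.single a b 1))
      (∑ l, D.weight l * ∑ i, ∑ j, π l i j *
        (2 * ((D.x l i a - D.y j a) * ∑ a, (D.x l i a - D.y j a) * U a b))) 0 := by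
    simp only [Data.f]
    exact HasDerivAt.fun_sum fun l _ => (HasDerivAt.fun_sum fun i _ => HasDerivAt.fun_sum
      fun j _ => (h1 l i j).const_mul _).const_mul _
  rw [h2.deriv]
  simp only [Finset.mul_sum, mul_left_comm (2 : ℝ)]

lemma tangentProjAlg_val (U G : Matrix (Fin d) (Fin k) ℝ) :
    (tangentProjAlg U G).val = tangentProj U G := by
  ext a b
  have h : (tangentProjAlg U G).val a b = G a b - ∑ c, U a c *
    ((∑ a, U a c * G a b + ∑ a, U a b * G a c) / 2) := rfl
  rw [h, tangentProj, Matrix.sub_apply, Matrix.mul_apply]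
  congr 1
  refine Finset.sum_congr rfl fun c _ => ?_
  simp only [Matrix.smul_apply, Matrix.add_apply, Matrix.mul_apply, Matrix.transpose_apply,
    smul_eq_mul, mul_comm (G _ c)]
  ring

/-! ## The ascent of the regularized value function -/

/-- The potentials that are admitted for the matrix `U`. -/
def Data.Good (D : Data m n d) (η : ℝ) (U : Matrix (Fin d) (Fin k) ℝ)
    (s : (Fin m → Fin n → ℝ) × (Fin m → Fin n → ℝ)) : Prop :=
  GoodState D η D.cbar (D.costMat U) s

/-- The plans of a pair of potentials for the matrix `U`. -/
noncomputable def Data.plan (D : Data m n d) (η : ℝ) (U : Matrix (Fin d) (Fin k) ℝ)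
    (s : (Fin m → Fin n → ℝ) × (Fin m → Fin n → ℝ)) : Fin m → Fin n → Fin n → ℝ :=
  zeta η (D.costMat U) s.1 s.2

/-- The regularized value function, as the supremum of the dual objective. -/
noncomputable def Data.value (D : Data m n d) (η : ℝ) (U : Matrix (Fin d) (Fin k) ℝ) : ℝ :=
  sSup ((fun s => D.dual s.1) '' {s | D.Good η U s})

/-- The iterations themselves, started at zero potentials, serve as an existence proof; these states
replace exact dual maximizers. -/
lemma exists_good [NeZero n] (D : Data m n d) {η : ℝ} (hη : 0 < η) (hc : 0 < D.cbar)
    {U : Matrix (Fin d) (Fin k) ℝ} (hU : U ∈ Stiefel d k) {δ : ℝ} (hδ : 0 < δ) :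
    ∃ s, D.Good η U s ∧ D.err (D.plan η U s) ≤ δ := by
  obtain ⟨N, -, hN⟩ := exists_err_le D hη hc hδ (projCost_nonneg D U) (projCost_le D hU)
    (s := (0, 0)) (by simp)
  exact ⟨_, goodState_iterate_next D hη (projCost_nonneg D U) (projCost_le D hU) (by simp) N, hN⟩

lemma dual_sub_dual_ge_dist (D : Data m n d) {η : ℝ} {U V : Matrix (Fin d) (Fin k) ℝ}
    {s s' : (Fin m → Fin n → ℝ) × (Fin m → Fin n → ℝ)} (hs : D.Good η U s)
    (hs' : D.Good η V s') :
    (D.pair (D.plan η V s') (D.costMat V) - D.pair (D.plan η V s') (D.costMat U)) / η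
      + D.dist (D.plan η V s') (D.plan η U s) ^ 2 / 4
      - 2 * (D.cbar / η) * D.err (D.plan η V s') ≤ D.dual s'.1 - D.dual s.1 := by
  have h1 := dual_sub_dual_ge D hs hs'
  have h2 := dist_sq_le_kl D (zeta_pos η (D.costMat V) s'.1 s'.2)
    (zeta_pos η (D.costMat U) s.1 s.2) hs'.row hs.row
  simp only [Data.plan]
  linarith

lemma dual_le_dual_add (D : Data m n d) {η : ℝ} {U : Matrix (Fin d) (Fin k) ℝ}
    {s s' : (Fin m → Fin n → ℝ) × (Fin m → Fin n → ℝ)} (hs : D.Good η U s)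
    (hs' : D.Good η U s') :
    D.dual s'.1 ≤ D.dual s.1 + 2 * (D.cbar / η) * D.err (D.plan η U s) := by
  have h := dual_sub_dual_ge_dist D hs' hs
  rw [sub_self, zero_div] at h
  nlinarith [sq_nonneg (D.dist (D.plan η U s) (D.plan η U s'))]

lemma value_le (D : Data m n d) {η : ℝ} {U : Matrix (Fin d) (Fin k) ℝ}
    {s : (Fin m → Fin n → ℝ) × (Fin m → Fin n → ℝ)} (hs : D.Good η U s) :
    D.value η U ≤ D.dual s.1 + 2 * (D.cbar / η) * D.err (D.plan η U s) := by
  refine csSup_le ⟨_, s, hs, rfl⟩ ?_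
  rintro _ ⟨s', hs', rfl⟩
  exact dual_le_dual_add D hs hs'

lemma le_value (D : Data m n d) {η : ℝ} {U : Matrix (Fin d) (Fin k) ℝ}
    {s : (Fin m → Fin n → ℝ) × (Fin m → Fin n → ℝ)} (hs : D.Good η U s) :
    D.dual s.1 ≤ D.value η U := by
  refine le_csSup ⟨D.dual s.1 + 2 * (D.cbar / η) * D.err (D.plan η U s), ?_⟩ ⟨s, hs, rfl⟩
  rintro _ ⟨s', hs', rfl⟩
  exact dual_le_dual_add D hs hs'

lemma pair_costMat_le (D : Data m n d) {U V : Matrix (Fin d) (Fin k) ℝ} (hU : U ∈ Stiefel d k)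
    {Z : Fin m → Fin n → Fin n → ℝ} (hZ0 : ∀ l i j, 0 ≤ Z l i j)
    (hZ : ∀ l i, ∑ j, Z l i j = D.p l i) :
    -D.cbar ≤ D.pair Z (D.costMat V) - D.pair Z (D.costMat U) := by
  rw [pair_sub_pair]
  refine le_pair D (fun l i j => ?_) hZ0 hZ
  have h1 := projCost_le D hU l i j
  have h2 := projCost_nonneg D V l i j
  change -D.cbar ≤ D.projCost V l i j - D.projCost U l i j
  linarith

/-- The value function varies by at most `2 c̄ / η`. -/
lemma value_sub_value_le [NeZero n] (D : Data m n d) {η : ℝ} (hη : 0 < η) (hc : 0 < D.cbar)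
    {U V : Matrix (Fin d) (Fin k) ℝ} (hU : U ∈ Stiefel d k) (hV : V ∈ Stiefel d k) :
    η * (D.value η V - D.value η U) ≤ 2 * D.cbar := by
  -- The costs contribute `c̄/η` and the two column errors `(2c̄/η)/8` each, within `2c̄/η`.
  obtain ⟨s, hs, hse⟩ := exists_good D hη hc hU (δ := 1 / 8) (by norm_num)
  obtain ⟨s', hs', hse'⟩ := exists_good D hη hc hV (δ := 1 / 8) (by norm_num)
  have h1 := dual_sub_dual_ge_dist D hs' hs
  have h2 := value_le D hs'
  have h3 := le_value D hs
  have h4 := pair_costMat_le D (V := U) hV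
    (fun l i j => (zeta_pos η (D.costMat U) s.1 s.2 l i j).le) hs.row
  have h5 := div_le_div_of_nonneg_right h4 hη.le
  have e := div_pos hc hη
  have h6 : D.value η V - D.value η U ≤ 2 * (D.cbar / η) := by
    simp only [Data.plan, neg_div] at *
    nlinarith [sq_nonneg (D.dist (zeta η (D.costMat U) s.1 s.2) (zeta η (D.costMat V) s'.1 s'.2)),
      mul_le_mul_of_nonneg_left hse e.le, mul_le_mul_of_nonneg_left hse' e.le]
  calc η * (D.value η V - D.value η U) ≤ η * (2 * (D.cbar / η)) := by gcongr
    _ = 2 * D.cbar := by field_simp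

set_option maxHeartbeats 1000000 in
/-- The gain of one step of the ascent. -/
lemma value_gain [NeZero n] (D : Data m n d) {η τ ε E L₁ L₂ : ℝ} (hη : 0 < η) (hc : 0 < D.cbar)
    (hε : 0 < ε) (hεc : ε ≤ D.cbar) (hηε : η ≤ ε / 2) (hE : E = η * ε ^ 2 / (200 * D.cbar ^ 3))
    (hτ0 : 0 < τ)
    (hτ : τ * (2 * D.cbar * L₂ + 4 * D.cbar ^ 2 * L₁ ^ 2 / η) ≤ 1 / 2)
    {U V ξ : Matrix (Fin d) (Fin k) ℝ} (hU : U ∈ Stiefel d k) (hV : V ∈ Stiefel d k)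
    (hV1 : ‖V - U‖ ≤ L₁ * ‖τ • ξ‖) (hV2 : ‖V - (U + τ • ξ)‖ ≤ L₂ * ‖τ • ξ‖ ^ 2)
    {s : (Fin m → Fin n → ℝ) × (Fin m → Fin n → ℝ)} (hs : D.Good η U s)
    (hsE : D.err (D.plan η U s) ≤ E) {R : Fin m → Matrix (Fin n) (Fin n) ℝ}
    (hR : D.dist R (D.plan η U s) ≤ 2 * E)
    (hRξ : 2 * D.pair R (D.biMat U ξ) = ‖ξ‖ ^ 2) (hξ : ε < ‖ξ‖) :
    τ * ε ^ 2 / 20 ≤ η * (D.value η V - D.value η U) := by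
  set c := D.cbar with hcdef
  set X := ‖ξ‖ with hX
  have hX0 : 0 < X := hε.trans hξ
  have hE0 : 0 < E := by rw [hE]; positivity
  have hnorm : ‖τ • ξ‖ = τ * X := by rw [norm_smul, Real.norm_of_nonneg hτ0.le]
  rw [hnorm] at hV1 hV2
  -- The auxiliary states `s'` at `U` and `t` at `V` are so accurate that their errors cost at most
  -- `4cδ ≤ τX²/25`. The state `s` of the algorithm has only accuracy `E`, and enters through the
  -- direction `ξ` alone.
  set δ := min E (τ * X ^ 2 / (100 * c)) with hδ
  have hδ0 : 0 < δ := lt_min hE0 (by positivity)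
  have hδE : δ ≤ E := min_le_left _ _
  have hδ2 : c * δ ≤ τ * X ^ 2 / 100 := by
    have := mul_le_mul_of_nonneg_left (min_le_right E (τ * X ^ 2 / (100 * c))) hc.le
    have e : c * (τ * X ^ 2 / (100 * c)) = τ * X ^ 2 / 100 := by field_simp
    linarith
  obtain ⟨s', hs', hse'⟩ := exists_good D hη hc hU hδ0
  obtain ⟨t, ht, hte⟩ := exists_good D hη hc hV hδ0
  set Z := D.plan η U s with hZ
  set Z' := D.plan η U s' with hZ'
  set Z₁ := D.plan η V t with hZ₁
  have hec : 0 < c / η := div_pos hc hη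
  -- the plans of `s` and `s'` are close
  have hdist : D.dist Z' Z ≤ ε / (5 * c) := by
    have h1 := dual_sub_dual_ge_dist D hs hs'
    have h2 := dual_sub_dual_ge_dist D hs' hs
    rw [sub_self, zero_div, zero_add, D.dist_comm] at h2
    rw [sub_self, zero_div, zero_add] at h1
    have h3 : D.dist Z' Z ^ 2 ≤ 8 * (c / η) * E := by
      nlinarith [mul_le_mul_of_nonneg_left (hse'.trans hδE) hec.le,
        mul_le_mul_of_nonneg_left hsE hec.le]
    -- The threshold of the subroutine is what makes this a perfect square.
    have h4 : 8 * (c / η) * E = (ε / (5 * c)) ^ 2 := by rw [hE]; field_simp; norm_num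
    rw [h4] at h3
    exact (abs_le_of_sq_le_sq' h3 (by positivity)).2
  have hE1 : 2 * E ≤ ε / (200 * c) := by
    have e1 : 2 * E = η * ε ^ 2 / (100 * c ^ 3) := by rw [hE]; field_simp; norm_num
    have e2 : η * ε ^ 2 / (100 * c ^ 3) ≤ (c / 2) * (ε * c) / (100 * c ^ 3) := by
      have : η ≤ c / 2 := by linarith
      have : ε ^ 2 ≤ ε * c := by nlinarith
      gcongr
    have e3 : (c / 2) * (ε * c) / (100 * c ^ 3) = ε / (200 * c) := by field_simp; norm_num
    linarith
  have hdistR : D.dist Z' R ≤ 41 / 200 * (ε / c) := by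
    have h1 := D.dist_triangle Z' Z R
    rw [D.dist_comm Z (fun l => R l)] at h1
    have e1 : ε / (5 * c) = 1 / 5 * (ε / c) := by field_simp
    have e2 : ε / (200 * c) = 1 / 200 * (ε / c) := by field_simp
    linarith
  -- the first-order change of the transport cost
  have hB : X ^ 2 - 41 / 100 * X ^ 2 ≤ 2 * D.pair Z' (D.biMat U ξ) := by
    have h1 := abs_le.1 (abs_pair_sub_le D (abs_biMat_le D hU hc.le ξ) Z' R)
    have h2 : D.dist Z' R * (c * X) ≤ 41 / 200 * (ε / c) * (c * X) := by gcongr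
    have h3 : 41 / 200 * (ε / c) * (c * X) = 41 / 200 * ε * X := by field_simp
    have h4 : ε * X ≤ X ^ 2 := by nlinarith
    have h5 := h1.1
    simp only [← hcdef, ← hX] at h5
    linarith
  have hlin : τ * (2 * D.pair Z' (D.biMat U ξ)) - 2 * c * (L₂ * (τ * X) ^ 2)
      ≤ D.pair Z' (D.costMat V) - D.pair Z' (D.costMat U) := by
    have e1 : τ * (2 * D.pair Z' (D.biMat U ξ)) = D.pair Z' (fun l => (τ * 2) • D.biMat U ξ l) := by
      rw [pair_mul]; ring
    have e2 : -(2 * c * (L₂ * (τ * X) ^ 2)) ≤ D.pair Z' (fun l => (D.costMat V l - D.costMat U l)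
        - (τ * 2) • D.biMat U ξ l) := by
      refine le_pair D (fun l i j => ?_) (fun l i j => (zeta_pos η (D.costMat U) s'.1 s'.2 l i j).le)
        hs'.row
      change _ ≤ D.projCost V l i j - D.projCost U l i j - (τ * 2) * D.biMat U ξ l i j
      rw [projCost_sub]
      have f1 : D.biMat U (V - U) l i j
          = τ * D.biMat U ξ l i j + D.biMat U (V - (U + τ • ξ)) l i j := by
        rw [← biMat_smul, ← biMat_add]
        congr 1
        abel
      have f2 := (abs_le.1 (abs_biMat_le D hU hc.le (V - (U + τ • ξ)) l i j)).1
      have f3 := projCost_nonneg D (V - U) l i j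
      have f4 := mul_le_mul_of_nonneg_left hV2 hc.le
      rw [f1]
      linarith
    rw [← pair_sub_pair, ← pair_sub_pair] at e2
    linarith
  -- The comparison below uses the plans `Z₁` at `V`, whereas the linearization was done for `Z'`.
  -- The exchange costs a product of two small quantities.
  have hcross : -(D.dist Z₁ Z' * (2 * c * (L₁ * (τ * X)))) ≤
      (D.pair Z₁ (D.costMat V) - D.pair Z₁ (D.costMat U))
        - (D.pair Z' (D.costMat V) - D.pair Z' (D.costMat U)) := by
    rw [pair_sub_pair, pair_sub_pair]
    refine (abs_le.1 (abs_pair_sub_le D (fun l i j => ?_) Z₁ Z')).1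
    refine (abs_projCost_sub_le D hU hV hc.le l i j).trans ?_
    exact mul_le_mul_of_nonneg_left hV1 (by positivity)
  have hmain := dual_sub_dual_ge_dist D hs' ht
  have hv1 := le_value D ht
  have hv2 := value_le D hs'
  set a := D.dist Z₁ Z' with ha
  have hval : (D.pair Z₁ (D.costMat V) - D.pair Z₁ (D.costMat U)) / η + a ^ 2 / 4
      - 4 * (c / η) * δ ≤ D.value η V - D.value η U := by
    have g1 := mul_le_mul_of_nonneg_left hse' hec.le
    have g2 := mul_le_mul_of_nonneg_left hte hec.le
    linarith
  have hval2 := mul_le_mul_of_nonneg_left hval hη.le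
  have e1 : η * ((D.pair Z₁ (D.costMat V) - D.pair Z₁ (D.costMat U)) / η + a ^ 2 / 4
      - 4 * (c / η) * δ) = (D.pair Z₁ (D.costMat V) - D.pair Z₁ (D.costMat U)) + η * a ^ 2 / 4
      - 4 * (c * δ) := by field_simp
  -- Completing the square: the Pinsker term absorbs the cross term at the price of a quadratic term
  -- in the step.
  have hsq : -(4 * c ^ 2 * L₁ ^ 2 / η * (τ * X) ^ 2)
      ≤ η * a ^ 2 / 4 - a * (2 * c * (L₁ * (τ * X))) := by
    have h0 : 0 ≤ (η * a / 2 - 2 * c * (L₁ * (τ * X))) ^ 2 / η := by positivity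
    have h1 : (η * a / 2 - 2 * c * (L₁ * (τ * X))) ^ 2 / η = η * a ^ 2 / 4
        - a * (2 * c * (L₁ * (τ * X))) + 4 * c ^ 2 * L₁ ^ 2 / η * (τ * X) ^ 2 := by
      field_simp; ring
    linarith
  have hτ' := mul_le_mul_of_nonneg_left hτ (by positivity : 0 ≤ τ * X ^ 2)
  have hB' := mul_le_mul_of_nonneg_left hB hτ0.le
  have hfin : τ * ε ^ 2 ≤ τ * X ^ 2 := by gcongr
  have e2 : τ * X ^ 2 * (τ * (2 * c * L₂ + 4 * c ^ 2 * L₁ ^ 2 / η))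
    = 2 * c * (L₂ * (τ * X) ^ 2) + 4 * c ^ 2 * L₁ ^ 2 / η * (τ * X) ^ 2 := by ring
  -- Balance in units of `τX²`: `59/100` from the derivative, `1/2` lost to quadratic terms by `hτ`,
  -- `4/100` to `δ`; `1/20` remains.
  linarith

/-! ## Operation counts -/

lemma ops_bind {α β : Type} (x : Counted α) (f : α → Counted β) :
    (x >>= f).ops = x.ops + (f x.val).ops := rfl
lemma val_bind {α β : Type} (x : Counted α) (f : α → Counted β) :
    (x >>= f).val = (f x.val).val := rfl
lemma ops_pure {α : Type} (a : α) : (pure a : Counted α).ops = 0 := rfl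
lemma ops_cAdd (a b : ℝ) : (cAdd a b).ops = 1 := rfl
lemma ops_cSub (a b : ℝ) : (cSub a b).ops = 1 := rfl
lemma ops_cMul (a b : ℝ) : (cMul a b).ops = 1 := rfl
lemma ops_cDiv (a b : ℝ) : (cDiv a b).ops = 1 := rfl
lemma ops_cExp (a : ℝ) : (cExp a).ops = 1 := rfl
lemma ops_cLog (a : ℝ) : (cLog a).ops = 1 := rfl
lemma ops_cSqrt (a : ℝ) : (cSqrt a).ops = 1 := rfl
lemma ops_cAbs (a : ℝ) : (cAbs a).ops = 1 := rfl
lemma ops_cMin (a b : ℝ) : (cMin a b).ops = 1 := rfl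
lemma ops_cLe (a b : ℝ) : (cLe a b).ops = 1 := rfl
lemma ops_cAll {ι α : Type} [Fintype ι] (f : ι → Counted α) :
    (cAll f).ops = ∑ i, (f i).ops := rfl
lemma ops_cMatrix {ι κ : Type} [Fintype ι] [Fintype κ] (f : ι → κ → Counted ℝ) :
    (cMatrix f).ops = ∑ i, ∑ j, (f i j).ops := rfl
lemma ops_cSum {ι : Type} [Fintype ι] (f : ι → Counted ℝ) :
    (cSum f).ops = ∑ i, (f i).ops + Fintype.card ι := rfl
lemma ops_cMax {ι : Type} [Fintype ι] (f : ι → Counted ℝ) :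
    (cMax f).ops = ∑ i, (f i).ops + Fintype.card ι := rfl

lemma ops_roundAlg (π : Matrix (Fin n) (Fin n) ℝ) (p q : Fin n → ℝ) :
    (roundAlg π p q).ops = 9 * n ^ 2 + 8 * n := by
  simp only [roundAlg, ops_bind, ops_pure, ops_cAdd, ops_cSub, ops_cMul, ops_cDiv, ops_cAbs,
    ops_cMin, ops_cAll, ops_cMatrix, ops_cSum, Finset.sum_const, Finset.card_univ,
    Fintype.card_fin, smul_eq_mul]
  ring

lemma ops_zetaAlg (η : ℝ) (M : Fin m → Matrix (Fin n) (Fin n) ℝ) (u v : Fin m → Fin n → ℝ) :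
    (zetaAlg η M u v).ops = 4 * (m * n ^ 2) := by
  simp only [zetaAlg, ops_bind, ops_cAdd, ops_cSub, ops_cExp, ops_cDiv,
    ops_cAll, ops_cMatrix, Finset.sum_const, Finset.card_univ,
    Fintype.card_fin, smul_eq_mul]
  ring

lemma ops_projCostAlg_le (D : Data m n d) (U : Matrix (Fin d) (Fin k) ℝ) (hd : 1 ≤ d) :
    (projCostAlg D U).ops ≤ 5 * (m * n ^ 2 * d * k) := by
  have h : (projCostAlg D U).ops = 3 * (m * n ^ 2 * d * k) + 2 * (m * n ^ 2 * 1 * k) := by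
    simp only [projCostAlg, ops_bind, ops_cSub, ops_cMul,
      ops_cAll, ops_cMatrix, ops_cSum, Finset.sum_const, Finset.card_univ,
      Fintype.card_fin, smul_eq_mul]
    ring
  have : m * n ^ 2 * 1 * k ≤ m * n ^ 2 * d * k := by gcongr
  omega

lemma ops_ibpIter_le (D : Data m n d) (η thr : ℝ) (M : Fin m → Matrix (Fin n) (Fin n) ℝ)
    (s : (Fin m → Fin n → ℝ) × (Fin m → Fin n → ℝ)) (hm : 1 ≤ m) (hn : 1 ≤ n) :
    (ibpIter D η thr M s).ops ≤ 60 * (m * n ^ 2) := by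
  have h1 : m * n ≤ m * n ^ 2 := by gcongr; nlinarith
  have h2 : n ≤ m * n := by nlinarith
  have h3 : m ≤ m * n := by nlinarith
  simp only [ibpIter, ops_bind, ops_cAdd, ops_cSub, ops_cMul, ops_cDiv, ops_cAbs, ops_cLog,
    ops_cExp, ops_cLe, ops_pure, ops_zetaAlg, ops_cAll, ops_cSum, Finset.sum_const,
    Finset.card_univ, Fintype.card_fin, smul_eq_mul]
  split <;>
    simp only [ops_bind, ops_pure, ops_cAll, ops_roundAlg, Finset.sum_const, Finset.card_univ,
      Fintype.card_fin, smul_eq_mul] <;> nlinarith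

/-- The projected differences are tabulated before the sums and `V_π` is never formed, so the cost
stays linear in `d`. -/
lemma ops_gradAlg_le (D : Data m n d) (π : Fin m → Matrix (Fin n) (Fin n) ℝ)
    (U : Matrix (Fin d) (Fin k) ℝ) (hm : 1 ≤ m) (hn : 1 ≤ n) :
    (gradAlg D π U).ops ≤ 20 * (m * n ^ 2 * d * k) := by
  have h1 : m * n * (d * k) ≤ m * n ^ 2 * (d * k) := by gcongr; nlinarith
  have h2 : m * 1 * (d * k) ≤ m * n * (d * k) := by gcongr
  have h3 : 1 * 1 * (d * k) ≤ m * 1 * (d * k) := by gcongr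
  simp only [gradAlg, ops_bind, ops_cSub, ops_cMul,
    ops_cAll, ops_cMatrix, ops_cSum, Finset.sum_const, Finset.card_univ,
    Fintype.card_fin, smul_eq_mul]
  nlinarith

lemma ops_tangentProjAlg_le (U G : Matrix (Fin d) (Fin k) ℝ) (hd : 1 ≤ d) (hk : 1 ≤ k) :
    (tangentProjAlg U G).ops ≤ 7 * (d * k ^ 2) := by
  have h1 : d * k ≤ d * k ^ 2 := by gcongr; nlinarith
  have h2 : 1 * k ^ 2 ≤ d * k ^ 2 := by gcongr
  simp only [tangentProjAlg, ops_bind, ops_cSub, ops_cMul, ops_cAdd, ops_cDiv,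
    ops_cMatrix, ops_cSum, Finset.sum_const, Finset.card_univ,
    Fintype.card_fin, smul_eq_mul]
  nlinarith

lemma ops_setParams_le (D : Data m n d) (L₁ L₂ ε : ℝ) (hm : 1 ≤ m) (hn : 1 ≤ n) (hd : 1 ≤ d) :
    (setParams D L₁ L₂ ε).ops ≤ 30 * (m * n ^ 2 * d) := by
  have h1 : m * n ^ 2 * 1 ≤ m * n ^ 2 * d := by gcongr
  have h2 : 1 * 1 ^ 2 ≤ m * n ^ 2 := by gcongr
  simp only [setParams, ops_bind, ops_cSub, ops_cMul, ops_cAdd, ops_cDiv, ops_cLog, ops_pure,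
    ops_cMax, ops_cSum, Finset.sum_const, Finset.card_univ, Fintype.card_prod,
    Fintype.card_fin, smul_eq_mul]
  nlinarith

/-! ## Loops -/

/-- A loop terminates if a bounded potential increases by a fixed amount in each iteration that
does not break out of the loop. -/
lemma exists_mem_cLoop {σ β : Type} {body : ℕ → σ → Part (Counted (β ⊕ σ))} {P : σ → Prop}
    {Q : β → Prop} {φ : σ → ℝ} {γ K B : ℝ} (hγ : 0 < γ)
    (hK : ∀ s s', P s → P s' → φ s' - φ s ≤ K) (hB : 0 ≤ B)
    (h : ∀ t s, P s → ∃ r ∈ body t s, (r.ops : ℝ) ≤ B ∧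
      ((∃ b, r.val = Sum.inl b ∧ Q b) ∨ ∃ s', r.val = Sum.inr s' ∧ P s' ∧ γ ≤ φ s' - φ s))
    {s₀ : σ} (hs₀ : P s₀) :
    ∃ r ∈ cLoop body s₀, Q r.val ∧ (r.ops : ℝ) ≤ (K / γ + 2) * B := by
  -- `N` counts the gains `γ` that the potential can still afford; the extra iteration in `N + 1` is
  -- the one that breaks.
  have key : ∀ (N : ℕ) (t : ℕ) (s : σ) (c : ℕ), P s → (∀ s', P s' → φ s' - φ s ≤ N * γ) →
      ∃ r ∈ (cLoopStep body).fix (t, s, c), Q r.val ∧ (r.ops : ℝ) ≤ c + (N + 1) * B := by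
    intro N
    induction N with
    | zero =>
      intro t s c hs hN
      obtain ⟨r, hr, hrB, ⟨b, hb, hQ⟩ | ⟨s', -, hs', hγ'⟩⟩ := h t s hs
      · refine ⟨⟨b, c + r.ops⟩, PFun.mem_fix_iff.2 (Or.inl (Part.mem_map_iff _ |>.2 ⟨r, hr, ?_⟩)),
          hQ, ?_⟩
        · rw [hb]
        · push_cast; linarith
      · have := hN s' hs'
        simp only [Nat.cast_zero, zero_mul] at this
        linarith
    | succ N ih =>
      intro t s c hs hN
      obtain ⟨r, hr, hrB, ⟨b, hb, hQ⟩ | ⟨s', hs's, hs', hγ'⟩⟩ := h t s hs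
      · refine ⟨⟨b, c + r.ops⟩, PFun.mem_fix_iff.2 (Or.inl (Part.mem_map_iff _ |>.2 ⟨r, hr, ?_⟩)),
          hQ, ?_⟩
        · rw [hb]
        · push_cast
          nlinarith [mul_nonneg (Nat.cast_nonneg (α := ℝ) N) hB]
      · obtain ⟨r', hr', hQ, hops⟩ := ih (t + 1) s' (c + r.ops) hs' (fun s'' hs'' => by
          have := hN s'' hs''
          push_cast at this
          linarith)
        refine ⟨r', PFun.mem_fix_iff.2 (Or.inr ⟨(t + 1, s', c + r.ops),
          Part.mem_map_iff _ |>.2 ⟨r, hr, ?_⟩, hr'⟩), hQ, ?_⟩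
        · rw [hs's]
        · push_cast at hops ⊢
          linarith
  have hK0 : 0 ≤ K := by simpa using hK s₀ s₀ hs₀ hs₀
  obtain ⟨r, hr, hQ, hops⟩ := key ⌈K / γ⌉₊ 0 s₀ 0 hs₀ (fun s' hs' => by
    refine (hK s₀ s' hs₀ hs').trans ?_
    rw [← div_le_iff₀ hγ]
    exact Nat.le_ceil _)
  refine ⟨r, hr, hQ, hops.trans ?_⟩
  have := (Nat.ceil_lt_add_one (div_nonneg hK0 hγ.le)).le
  rw [Nat.cast_zero, zero_add]
  exact mul_le_mul_of_nonneg_right (by linarith) hB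

/-! ## The subroutine -/

lemma costMat_eq (D : Data m n d) (U : Matrix (Fin d) (Fin k) ℝ) :
    (projCostAlg D U).val = D.costMat U := by
  funext l
  ext i j
  simp only [Data.costMat, Matrix.of_apply, Data.projCost, sq]
  rfl

lemma ibpIter_val (D : Data m n d) (η thr : ℝ) (M : Fin m → Matrix (Fin n) (Fin n) ℝ)
    (s : (Fin m → Fin n → ℝ) × (Fin m → Fin n → ℝ)) :
    (ibpIter D η thr M s).val =
      if D.err (zeta η M (D.next η M s).1 (D.next η M s).2) ≤ thr
      then Sum.inl (D.roundPlan η M (D.next η M s)) else Sum.inr (D.next η M s) := by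
  simp only [ibpIter, val_bind]
  split
  · rename_i h
    rw [if_pos (show D.err (zeta η M (D.next η M s).1 (D.next η M s).2) ≤ thr
      from of_decide_eq_true h)]
    rfl
  · rename_i h
    rw [if_neg (fun h' : D.err (zeta η M (D.next η M s).1 (D.next η M s).2) ≤ thr =>
      h (decide_eq_true h'))]
    rfl

/-- The subroutine terminates within the given number of operations, and it returns the rounded
plans of potentials that are nearly optimal. -/
lemma exists_mem_ibpSolver [NeZero n] (D : Data m n d) {η thr : ℝ} (hη : 0 < η) (hc : 0 < D.cbar)
    (hthr : 0 < thr) (hm : 1 ≤ m) (hd : 1 ≤ d) {U : Matrix (Fin d) (Fin k) ℝ}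
    (hU : U ∈ Stiefel d k) (u₀ v₀ : Fin m → Fin n → ℝ)
    (hv : ∀ j, ∑ l, D.weight l * v₀ l j = 0) :
    ∃ r ∈ ibpSolver D η thr U u₀ v₀, (∃ s, D.Good η U s ∧ D.err (D.plan η U s) ≤ thr ∧
        r.val = D.roundPlan η (D.costMat U) s) ∧
      (r.ops : ℝ) ≤ 5 * (m * n ^ 2 * d * k)
        + (5 + 64 * D.cbar / (η * thr)) * (60 * (m * n ^ 2)) := by
  have hn : 1 ≤ n := NeZero.one_le
  have hM0 : ∀ l i j, 0 ≤ D.costMat U l i j := projCost_nonneg D U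
  have hMc : ∀ l i j, D.costMat U l i j ≤ D.cbar := projCost_le D hU
  -- The test is known to succeed after `N + 1` iterations, but the loop may break earlier; both
  -- cases are covered by the induction.
  have key : ∀ (N : ℕ) (t : ℕ) (s : (Fin m → Fin n → ℝ) × (Fin m → Fin n → ℝ)) (c : ℕ),
      (∀ j, ∑ l, D.weight l * s.2 l j = 0) →
      D.err (D.plan η U ((D.next η (D.costMat U))^[N + 1] s)) ≤ thr →
      ∃ r ∈ (cLoopStep (fun _ s => Part.some (ibpIter D η thr (D.costMat U) s))).fix (t, s, c),
        (∃ s, D.Good η U s ∧ D.err (D.plan η U s) ≤ thr ∧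
          r.val = D.roundPlan η (D.costMat U) s) ∧ r.ops ≤ c + (N + 1) * (60 * (m * n ^ 2)) := by
    intro N
    induction N with
    | zero =>
      intro t s c hs hN
      have hv := ibpIter_val D η thr (D.costMat U) s
      replace hv := hv.trans (if_pos hN)
      refine ⟨⟨D.roundPlan η (D.costMat U) (D.next η (D.costMat U) s),
        c + (ibpIter D η thr (D.costMat U) s).ops⟩, PFun.mem_fix_iff.2 (Or.inl
        (Part.mem_map_iff _ |>.2 ⟨_, Part.mem_some _, by simp only [hv]⟩)),
        ⟨_, goodState_next D hη hM0 hMc hs, hN, rfl⟩, ?_⟩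
      have := ops_ibpIter_le D η thr (D.costMat U) s hm hn
      simp only
      omega
    | succ N ih =>
      intro t s c hs hN
      have hv := ibpIter_val D η thr (D.costMat U) s
      have hops := ops_ibpIter_le D η thr (D.costMat U) s hm hn
      by_cases hN0 : D.err (D.plan η U (D.next η (D.costMat U) s)) ≤ thr
      · replace hv := hv.trans (if_pos hN0)
        refine ⟨⟨D.roundPlan η (D.costMat U) (D.next η (D.costMat U) s),
        c + (ibpIter D η thr (D.costMat U) s).ops⟩, PFun.mem_fix_iff.2 (Or.inl
          (Part.mem_map_iff _ |>.2 ⟨_, Part.mem_some _, by simp only [hv]⟩)),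
          ⟨_, goodState_next D hη hM0 hMc hs, hN0, rfl⟩, ?_⟩
        simp only
        nlinarith
      · replace hv := hv.trans (if_neg hN0)
        obtain ⟨r, hr, hr1, hr2⟩ := ih (t + 1) (D.next η (D.costMat U) s)
          (c + (ibpIter D η thr (D.costMat U) s).ops) (goodState_next D hη hM0 hMc hs).bal hN
        refine ⟨r, PFun.mem_fix_iff.2 (Or.inr ⟨_, Part.mem_map_iff _ |>.2
          ⟨_, Part.mem_some _, by simp only [hv]⟩, hr⟩), hr1, ?_⟩
        nlinarith
  obtain ⟨N, hN, hN2⟩ := exists_err_le D hη hc hthr hM0 hMc (s := (u₀, v₀)) hv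
  obtain ⟨r, hr, hr1, hr2⟩ := key N 0 (u₀, v₀) 0 hv hN2
  refine ⟨⟨r.val, (projCostAlg D U).ops + r.ops⟩, ?_, hr1, ?_⟩
  · rw [ibpSolver]
    simp only [costMat_eq]
    exact Part.mem_map_iff _ |>.2 ⟨r, hr, rfl⟩
  · have h1 := ops_projCostAlg_le D U hd
    have h1' : ((projCostAlg D U).ops : ℝ) ≤ 5 * (m * n ^ 2 * d * k) := by exact_mod_cast h1
    have h2' : (r.ops : ℝ) ≤ 0 + (N + 1) * (60 * (m * n ^ 2)) := by exact_mod_cast hr2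
    have h3 : ((N : ℝ) + 1) * (60 * (m * n ^ 2))
        ≤ (5 + 64 * D.cbar / (η * thr)) * (60 * (m * n ^ 2)) :=
      mul_le_mul_of_nonneg_right (by linarith) (by positivity)
    push_cast
    linarith

/-! ## The step of the ascent -/

lemma ops_ascentStep_le (D : Data m n d)
    (retr : Matrix (Fin d) (Fin k) ℝ → Matrix (Fin d) (Fin k) ℝ →
      Counted (Matrix (Fin d) (Fin k) ℝ))
    (ε τ : ℝ) (U : Matrix (Fin d) (Fin k) ℝ) (π : Fin m → Matrix (Fin n) (Fin n) ℝ)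
    (hm : 1 ≤ m) (hn : 1 ≤ n) (hd : 1 ≤ d) (hk : 1 ≤ k) :
    (ascentStep D retr ε τ U π).ops ≤ 20 * (m * n ^ 2 * d * k) + 15 * (d * k ^ 2)
      + (retr U (τ • tangentProj U (gradAlg D π U).val)).ops := by
  have h1 := ops_gradAlg_le D π U hm hn
  have h2 := ops_tangentProjAlg_le U (gradAlg D π U).val hd hk
  have h3 : (cMatrix fun a b => cMul τ ((tangentProjAlg U (gradAlg D π U).val).val a b)).val
      = τ • tangentProj U (gradAlg D π U).val := by
    rw [tangentProjAlg_val]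
    ext a b
    rfl
  have h4 : d * k ≤ d * k ^ 2 := by gcongr; nlinarith
  have h5 : d * 1 ≤ d * k := by gcongr
  simp only [ascentStep, ops_bind, ops_cMul, ops_cLe, ops_cSqrt, ops_cSum, h3]
  simp only [ops_cMatrix, ops_cMul, Finset.sum_const, Finset.card_univ, Fintype.card_fin,
    smul_eq_mul]
  split <;> simp only [ops_pure] <;> nlinarith

lemma ascentStep_val (D : Data m n d)
    (retr : Matrix (Fin d) (Fin k) ℝ → Matrix (Fin d) (Fin k) ℝ →
      Counted (Matrix (Fin d) (Fin k) ℝ))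
    (ε τ : ℝ) (U : Matrix (Fin d) (Fin k) ℝ) (π : Fin m → Matrix (Fin n) (Fin n) ℝ) :
    (ascentStep D retr ε τ U π).val = if ‖tangentProj U (gradAlg D π U).val‖ ≤ ε
      then Sum.inl (π, U)
      else Sum.inr (retr U (τ • tangentProj U (gradAlg D π U).val)).val := by
  have h3 : (cMatrix fun a b => cMul τ ((tangentProjAlg U (gradAlg D π U).val).val a b)).val
      = τ • tangentProj U (gradAlg D π U).val := by
    rw [tangentProjAlg_val]
    ext a b
    rfl
  have h4 : (cSqrt (cSum fun a => cSum fun b =>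
      cMul ((tangentProjAlg U (gradAlg D π U).val).val a b)
        ((tangentProjAlg U (gradAlg D π U).val).val a b)).val).val
      = ‖tangentProj U (gradAlg D π U).val‖ := by
    rw [tangentProjAlg_val, ← Real.sqrt_sq (norm_nonneg (tangentProj U (gradAlg D π U).val)),
      frobenius_sq]
    simp only [sq]
    rfl
  simp only [ascentStep, val_bind, h3, h4]
  split
  · rename_i h
    rw [if_pos (of_decide_eq_true h)]
    rfl
  · rename_i h
    rw [if_neg (fun h' => h (decide_eq_true h'))]
    rfl

lemma setParams_val (D : Data m n d) (L₁ L₂ ε : ℝ) :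
    (setParams D L₁ L₂ ε).val = ⟨ε / (4 * Real.log n + 2),
      1 / (8 * L₂ * D.cbar
        + 2 * (2 * D.cbar + 4 * (D.cbar * D.cbar) / (ε / (4 * Real.log n + 2))) * (L₁ * L₁)),
      ε / (4 * Real.log n + 2) * (ε * ε) / (200 * (D.cbar * D.cbar * D.cbar))⟩ := by
  simp only [Data.cbar, Data.cost, sq]
  rfl

/-! ## One iteration of the ascent -/

/-- Regularization costs `2η log n`, the column error `c̄ * thr` and rounding `2c̄ * thr`. As `c̄ *
thr ≤ η/200`, the sum is below `η (4 log n + 2) = ε`. -/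
lemma isStationary_roundPlan [NeZero n] (D : Data m n d) {η ε thr : ℝ} (hη : 0 < η) (hε : 0 < ε)
    (hεc : ε ≤ D.cbar) (hηε : η * (4 * Real.log n + 2) = ε)
    (hthr : thr = η * ε ^ 2 / (200 * D.cbar ^ 3)) {U : Matrix (Fin d) (Fin k) ℝ}
    (hU : U ∈ Stiefel d k) {s : (Fin m → Fin n → ℝ) × (Fin m → Fin n → ℝ)} (hs : D.Good η U s)
    (hse : D.err (D.plan η U s) ≤ thr)
    (hgrad : ‖tangentProj U (gradAlg D (D.roundPlan η (D.costMat U) s) U).val‖ ≤ ε) :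
    D.IsStationary ε (D.roundPlan η (D.costMat U) s, U) := by
  have hc : 0 < D.cbar := hε.trans_le hεc
  obtain ⟨h1, h2⟩ := roundPlan_spec D hs
  refine ⟨h1, hU, ?_, fun π' hπ' => ?_⟩
  · rw [Data.riemannianGrad, euclideanGrad_f]
    exact hgrad
  · change D.pair (D.roundPlan η (D.costMat U) s) (D.costMat U) - D.pair π' (D.costMat U) ≤ ε
    have h3 := pair_zeta_le D hη hs hπ'
    have h4 := (abs_le.1 (abs_pair_sub_le D (c := D.cbar) (M := D.costMat U) (fun l i j => by
      change |D.projCost U l i j| ≤ D.cbar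
      rw [abs_of_nonneg (projCost_nonneg D U l i j)]
      exact projCost_le D hU l i j)
      (D.roundPlan η (D.costMat U) s) (D.plan η U s))).2
    have h5 : D.cbar * thr ≤ η / 200 := by
      have : D.cbar * thr = η / 200 * (ε ^ 2 / D.cbar ^ 2) := by rw [hthr]; field_simp
      rw [this]
      have h6 : ε ^ 2 / D.cbar ^ 2 ≤ 1 := (div_le_one (by positivity)).2 (by gcongr)
      exact mul_le_of_le_one_right (by positivity) h6
    have h6 := mul_le_mul_of_nonneg_left hse hc.le
    have h7 := mul_le_mul_of_nonneg_right h2 hc.le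
    simp only [Data.plan] at h4 h6
    linarith

/-- Here `k ≤ κ m n²` is used, to absorb `d k²` into `m n² d k`. Absolute values appear since `A`
and `κ` may have any sign. -/
lemma ops_retr_le {A κ : ℝ} {N : ℕ} {r : ℕ} (hkd : k ≤ d) (hk : (k : ℝ) ≤ κ * N)
    (hr : (r : ℝ) ≤ A * (d * k ^ 2 + k ^ 3)) :
    15 * (d * k ^ 2 : ℝ) + r ≤ (15 + 2 * |A|) * |κ| * (N * d * k) := by
  have hkd' : (k : ℝ) ≤ d := by exact_mod_cast hkd
  have h1 : (k : ℝ) ^ 3 ≤ d * k ^ 2 := by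
    rw [pow_succ, mul_comm]; gcongr
  have h2 : (d * k ^ 2 : ℝ) ≤ |κ| * (N * d * k) := by
    calc (d * k ^ 2 : ℝ) = k * (d * k) := by ring
      _ ≤ (|κ| * N) * (d * k) := by
        refine mul_le_mul_of_nonneg_right (hk.trans ?_) (by positivity)
        exact mul_le_mul_of_nonneg_right (le_abs_self κ) (by positivity)
      _ = _ := by ring
  have h3 : A * (d * k ^ 2 + k ^ 3 : ℝ) ≤ |A| * (2 * (d * k ^ 2)) := by
    calc A * (d * k ^ 2 + k ^ 3 : ℝ) ≤ |A| * (d * k ^ 2 + k ^ 3) :=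
          mul_le_mul_of_nonneg_right (le_abs_self A) (by positivity)
      _ ≤ _ := mul_le_mul_of_nonneg_left (by linarith) (abs_nonneg A)
  have h4 := mul_le_mul_of_nonneg_left h2 (abs_nonneg A)
  linarith

/-- If the gradient test succeeds, `isStationary_roundPlan` applies; if it fails, it supplies the
hypothesis `ε < ‖ξ‖` of `value_gain`, with the rounded plans as `R`. -/
lemma exists_mem_rgaIter [NeZero n] (D : Data m n d)
    {retr : Matrix (Fin d) (Fin k) ℝ → Matrix (Fin d) (Fin k) ℝ →
      Counted (Matrix (Fin d) (Fin k) ℝ)}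
    {A κ L₁ L₂ ε η τ thr : ℝ} {u₀ v₀ : ℕ → Fin m → Fin n → ℝ} (hm : 1 ≤ m) (hk1 : 1 ≤ k)
    (hkd : k ≤ d) (hk : (k : ℝ) ≤ κ * (m * n ^ 2))
    (hretr : IsRetraction (fun U ξ => (retr U ξ).val))
    (hops : ∀ U ∈ Stiefel d k, ∀ ξ ∈ tangentSpace U,
      ((retr U ξ).ops : ℝ) ≤ A * (d * k ^ 2 + k ^ 3))
    (hR1 : ∀ U ∈ Stiefel d k, ∀ ξ ∈ tangentSpace U, ‖(retr U ξ).val - U‖ ≤ L₁ * ‖ξ‖)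
    (hR2 : ∀ U ∈ Stiefel d k, ∀ ξ ∈ tangentSpace U,
      ‖(retr U ξ).val - (U + ξ)‖ ≤ L₂ * ‖ξ‖ ^ 2)
    (hε : 0 < ε) (hεc : ε ≤ D.cbar) (hv₀ : ∀ t j, ∑ l, D.weight l * v₀ t l j = 0)
    (hP : (setParams D L₁ L₂ ε).val = ⟨η, τ, thr⟩) (hη : 0 < η)
    (hηε : η * (4 * Real.log n + 2) = ε) (hτ0 : 0 < τ)
    (hτ : τ * (2 * D.cbar * L₂ + 4 * D.cbar ^ 2 * L₁ ^ 2 / η) ≤ 1 / 2)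
    (hthr : thr = η * ε ^ 2 / (200 * D.cbar ^ 3)) (t : ℕ) {U : Matrix (Fin d) (Fin k) ℝ}
    (hU : U ∈ Stiefel d k) :
    ∃ r ∈ rgaIter D retr L₁ L₂ ε u₀ v₀ t U,
      (r.ops : ℝ) ≤ (25 + (15 + 2 * |A|) * |κ|) * (m * n ^ 2 * d * k)
        + (5 + 64 * D.cbar / (η * thr)) * (60 * (m * n ^ 2)) ∧
      ((∃ b, r.val = Sum.inl b ∧ D.IsStationary ε b) ∨
        ∃ V, r.val = Sum.inr V ∧ V ∈ Stiefel d k ∧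
          τ * ε ^ 2 / 20 ≤ η * D.value η V - η * D.value η U) := by
  have hc : 0 < D.cbar := hε.trans_le hεc
  have hn : 1 ≤ n := NeZero.one_le
  have hd : 1 ≤ d := hk1.trans hkd
  have hthr0 : 0 < thr := by rw [hthr]; positivity
  obtain ⟨r, hr, ⟨s, hs, hse, hrs⟩, hrops⟩ := exists_mem_ibpSolver D hη hc hthr0 hm hd hU
    (u₀ t) (v₀ t) (hv₀ t)
  have hξ : τ • tangentProj U (gradAlg D r.val U).val ∈ tangentSpace U :=
    smul_mem_tangentSpace (tangentProj_mem hU _) τ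
  have hval := ascentStep_val D retr ε τ U r.val
  refine ⟨⟨(ascentStep D retr ε τ U r.val).val, r.ops + (ascentStep D retr ε τ U r.val).ops⟩,
    ?_, ?_, ?_⟩
  · simp only [rgaIter, hP]
    exact Part.mem_map_iff _ |>.2 ⟨r, hr, rfl⟩
  · have h1 := ops_ascentStep_le D retr ε τ U r.val hm hn hd hk1
    have h2 := ops_retr_le (N := m * n ^ 2) hkd (by exact_mod_cast hk) (hops U hU _ hξ)
    have h3 : ((ascentStep D retr ε τ U r.val).ops : ℝ) ≤ 20 * (m * n ^ 2 * d * k)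
        + 15 * (d * k ^ 2) + (retr U (τ • tangentProj U (gradAlg D r.val U).val)).ops := by
      exact_mod_cast h1
    push_cast at h2 ⊢
    linarith
  · by_cases h : ‖tangentProj U (gradAlg D r.val U).val‖ ≤ ε
    · rw [if_pos h] at hval
      refine Or.inl ⟨_, hval, ?_⟩
      rw [hrs] at h ⊢
      exact isStationary_roundPlan D hη hε hεc hηε hthr hU hs hse h
    · rw [if_neg h] at hval
      refine Or.inr ⟨_, hval, hretr.mem U hU _ hξ, ?_⟩
      rw [← mul_sub]
      have hlog : 0 ≤ Real.log n := Real.log_nonneg (by exact_mod_cast hn)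
      refine value_gain D hη hc hε hεc (by nlinarith) hthr hτ0 hτ hU (hretr.mem U hU _ hξ)
        (hR1 U hU _ hξ) (hR2 U hU _ hξ) hs hse (R := r.val) ?_ ?_ (not_le.1 h)
      · rw [hrs]
        exact (roundPlan_spec D hs).2.trans (by linarith [show D.err (zeta η (D.costMat U) s.1 s.2)
          ≤ thr from hse])
      · rw [← sum_gradAlg_mul, sum_mul_tangentProj hU]

/-! ## The bounds for the numbers of iterations -/

/-- The true order is `c⁴ L² / ε⁴`; a factor `c² / ε² ≥ 1` is given away. `L ≥ 2/3` is exactly `4L +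
2 ≤ 7L`. -/
lemma inner_count_le {c ε η L thr : ℝ} (hε : 0 < ε) (hεc : ε ≤ c) (hη : 0 < η)
    (hηε : η * (4 * L + 2) = ε) (hL : 2 / 3 ≤ L) (hthr : thr = η * ε ^ 2 / (200 * c ^ 3)) :
    64 * c / (η * thr) ≤ 627200 * (c ^ 6 * L ^ 2 / ε ^ 6) := by
  have hc : 0 < c := hε.trans_le hεc
  have h1 : 64 * c / (η * thr) = 12800 * (c ^ 4 * (4 * L + 2) ^ 2 / ε ^ 4) := by
    have h4 : 0 < 4 * L + 2 := by linarith
    have : η = ε / (4 * L + 2) := by rw [← hηε]; field_simp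
    rw [hthr, this]
    field_simp
    norm_num
  have h2 : (4 * L + 2) ^ 2 ≤ (7 * L) ^ 2 := by gcongr; linarith
  have h3 : 1 ≤ c ^ 2 / ε ^ 2 := (one_le_div (by positivity)).2 (by gcongr)
  rw [h1]
  calc 12800 * (c ^ 4 * (4 * L + 2) ^ 2 / ε ^ 4)
      ≤ 12800 * (c ^ 4 * (7 * L) ^ 2 / ε ^ 4) * (c ^ 2 / ε ^ 2) := by
        refine le_trans ?_ (le_mul_of_one_le_right (by positivity) h3)
        gcongr
    _ = 627200 * (c ^ 6 * L ^ 2 / ε ^ 6) := by field_simp; norm_num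

/-- With `x = c/ε` the count is cubic in `x` and linear in `L`, so `x⁴`, `L²` and `k` are generous.
The assumption on `L₂ ε` turns the retraction term of `1/τ` into a multiple of `L₁²`. Constants:
`720 = 40·8·9/4` and `3725 = 40·93 + 5`. -/
lemma outer_count_le {c ε η τ L L₁ L₂ κ k : ℝ} (hε : 0 < ε) (hεc : ε ≤ c) (hη : 0 < η)
    (hηε : η * (4 * L + 2) = ε) (hL : 2 / 3 ≤ L) (hL₁ : 1 ≤ L₁) (hL₂ : 0 < L₂)
    (hκ : L₂ * ε ≤ κ * (L₁ ^ 2 * c)) (hk : 1 ≤ k)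
    (hτ : τ = 1 / (8 * L₂ * c + 2 * (2 * c + 4 * (c * c) / η) * (L₁ * L₁))) :
    2 * c / (τ * ε ^ 2 / 20) + 2 ≤
      (720 * |κ| + 3725) * (L ^ 2 * L₁ ^ 2 * c ^ 4 * k / ε ^ 4) := by
  have hc : 0 < c := hε.trans_le hεc
  have hden : 0 < 8 * L₂ * c + 2 * (2 * c + 4 * (c * c) / η) * (L₁ * L₁) := by positivity
  set x := c / ε with hx
  have hx1 : 1 ≤ x := (one_le_div hε).2 hεc
  have hL4 : 0 < 4 * L + 2 := by linarith
  have hη' : η = ε / (4 * L + 2) := by rw [← hηε]; field_simp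
  have e1 : 2 * c / (τ * ε ^ 2 / 20)
      = 40 * (8 * ((L₂ * ε) / c) * x ^ 3 + L₁ ^ 2 * (4 * x ^ 2 + 8 * x ^ 3 * (4 * L + 2))) := by
    rw [hτ, hx]
    rw [hη'] at hden ⊢
    field_simp
    ring
  have e2 : L ^ 2 * L₁ ^ 2 * c ^ 4 * k / ε ^ 4 = L ^ 2 * (L₁ ^ 2 * x ^ 4) * k := by
    rw [hx]; field_simp
  have hL₁2 : 1 ≤ L₁ ^ 2 := one_le_pow₀ hL₁
  have hLL : 4 / 9 ≤ L ^ 2 := by nlinarith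
  have p2 : x ^ 2 ≤ x ^ 4 := pow_le_pow_right₀ hx1 (by norm_num)
  have p3 : x ^ 3 ≤ x ^ 4 := pow_le_pow_right₀ hx1 (by norm_num)
  have p4 : 1 ≤ x ^ 4 := one_le_pow₀ hx1
  set y := L₁ ^ 2 * x ^ 4 with hy
  have hy1 : 1 ≤ y := one_le_mul_of_one_le_of_one_le hL₁2 p4
  have f1 : (L₂ * ε) / c * x ^ 3 ≤ |κ| * y := by
    have : (L₂ * ε) / c ≤ |κ| * L₁ ^ 2 := by
      rw [div_le_iff₀ hc, mul_assoc]
      exact hκ.trans (mul_le_mul_of_nonneg_right (le_abs_self κ) (by positivity))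
    calc (L₂ * ε) / c * x ^ 3 ≤ (|κ| * L₁ ^ 2) * x ^ 4 := by gcongr
      _ = |κ| * y := by rw [hy]; ring
  have f2 : L₁ ^ 2 * (4 * x ^ 2 + 8 * x ^ 3 * (4 * L + 2)) ≤ y * (4 + 56 * L) := by
    calc L₁ ^ 2 * (4 * x ^ 2 + 8 * x ^ 3 * (4 * L + 2))
        ≤ L₁ ^ 2 * (4 * x ^ 4 + 8 * x ^ 4 * (7 * L)) := by gcongr; linarith
      _ = y * (4 + 56 * L) := by rw [hy]; ring
  have f3 : |κ| * y ≤ 9 / 4 * (|κ| * (L ^ 2 * y)) := by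
    have : y ≤ 9 / 4 * (L ^ 2 * y) := by
      have := mul_le_mul_of_nonneg_right hLL (zero_le_one.trans hy1)
      linarith
    calc |κ| * y ≤ |κ| * (9 / 4 * (L ^ 2 * y)) := by gcongr
      _ = _ := by ring
  have f4 : y * (4 + 56 * L) ≤ 93 * (L ^ 2 * y) := by
    have h : 4 + 56 * L ≤ 93 * L ^ 2 := by nlinarith
    have := mul_le_mul_of_nonneg_left h (zero_le_one.trans hy1)
    linarith
  have f5 : 2 ≤ 5 * (L ^ 2 * y) := by
    have := mul_le_mul hLL hy1 zero_le_one (sq_nonneg L)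
    linarith
  rw [e1, e2]
  calc _ ≤ (720 * |κ| + 3725) * (L ^ 2 * y) := by linarith
    _ ≤ (720 * |κ| + 3725) * (L ^ 2 * y * k) := by
      refine mul_le_mul_of_nonneg_left (le_mul_of_one_le_right (by positivity) hk) (by positivity)

lemma total_eq {ε : ℝ} (hε : ε ≠ 0) (w L C a N c : ℝ) :
    w * (C * (a / ε ^ 4 + N * c ^ 6 * L ^ 2 / ε ^ 10))
      = C * (w / ε ^ 4 * (a + N * c ^ 6 * L ^ 2 / ε ^ 6)) := by
  field_simp

/-- The setup cost `x` is charged to the main term through `F ≥ 4/9`, since `68 · 4/9 ≥ 30`. -/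
lemma add_le_total {C₁ C₂ F a b x y : ℝ} (hF : 4 / 9 ≤ F)
    (ha : 0 ≤ a) (hb : 0 ≤ b) (hx : x ≤ 30 * a) (hy : y ≤ C₂ * F * (C₁ * (a + b))) :
    x + y ≤ (C₂ * C₁ + 68) * (F * (a + b)) := by
  have h1 := mul_le_mul_of_nonneg_right hF (add_nonneg ha hb)
  calc x + y ≤ 68 * (F * (a + b)) + C₂ * F * (C₁ * (a + b)) := by linarith
    _ = _ := by ring

end RPRWB

open RPRWB
theorem mainTheorem3 :
    ∀ A κ : ℝ, ∃ C : ℝ, ∀ (m n d k : ℕ) (D : Data m n d)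
      (retr : Matrix (Fin d) (Fin k) ℝ → Matrix (Fin d) (Fin k) ℝ →
        Counted (Matrix (Fin d) (Fin k) ℝ))
      (L₁ L₂ ε : ℝ) (u₀ v₀ : ℕ → Fin m → Fin n → ℝ),
      2 ≤ n → 1 ≤ k → k ≤ d → (k : ℝ) ≤ κ * (m * n ^ 2) →
      IsRetraction (fun U ξ => (retr U ξ).val) →
      (∀ U ∈ Stiefel d k, ∀ ξ ∈ tangentSpace U,
        ((retr U ξ).ops : ℝ) ≤ A * (d * k ^ 2 + k ^ 3)) →
      1 ≤ L₁ → 0 < L₂ →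
      (∀ U ∈ Stiefel d k, ∀ ξ ∈ tangentSpace U, ‖(retr U ξ).val - U‖ ≤ L₁ * ‖ξ‖) →
      (∀ U ∈ Stiefel d k, ∀ ξ ∈ tangentSpace U, ‖(retr U ξ).val - (U + ξ)‖ ≤ L₂ * ‖ξ‖ ^ 2) →
      0 < ε → ε ≤ D.cbar → L₂ * ε ≤ κ * (L₁ ^ 2 * D.cbar) →
      (∀ t j, ∑ l, D.weight l * v₀ t l j = 0) →
      (∀ t, ∀ U ∈ Stiefel d k, ∃ r ∈ rgaIter D retr L₁ L₂ ε u₀ v₀ t U,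
        (r.ops : ℝ) ≤ C * (m * n ^ 2 * d * k
          + m * n ^ 2 * D.cbar ^ 6 * Real.log n ^ 2 / ε ^ 6)) ∧
      (∀ U₀ ∈ Stiefel d k, ∃ r ∈ rga D retr L₁ L₂ ε u₀ v₀ U₀,
        D.IsStationary ε r.val ∧
        (r.ops : ℝ) ≤ Real.log n ^ 2 * L₁ ^ 2 * D.cbar ^ 4 * k *
          (C * (m * n ^ 2 * d * k / ε ^ 4
            + m * n ^ 2 * D.cbar ^ 6 * Real.log n ^ 2 / ε ^ 10))) := by
  intro A κ
  -- Cost of one outer iteration: `325 = 25 + 5·60`, and `37632000 = 627200·60` is the inner count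
  -- times the cost of an inner pass.
  set C₁ : ℝ := 325 + (15 + 2 * |A|) * |κ| + 37632000 with hC₁
  set C₂ : ℝ := 720 * |κ| + 3725 with hC₂
  have hC₁0 : 1 ≤ C₁ := by
    have : 0 ≤ (15 + 2 * |A|) * |κ| := by positivity
    rw [hC₁]; linarith
  have hC₂0 : 1 ≤ C₂ := by rw [hC₂]; linarith [abs_nonneg κ]
  refine ⟨C₂ * C₁ + 68, ?_⟩
  intro m n d k D retr L₁ L₂ ε u₀ v₀ hn hk1 hkd hk hretr hops hL₁ hL₂ hR1 hR2 hε hεc hκ hv₀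
  have : NeZero n := ⟨by omega⟩
  have hm : 1 ≤ m := by
    rcases Nat.eq_zero_or_pos m with rfl | h
    · have := D.weight_sum
      simp at this
    · exact h
  have hd : 1 ≤ d := hk1.trans hkd
  have hc : 0 < D.cbar := hε.trans_le hεc
  set L := Real.log n with hLdef
  have hL : 2 / 3 ≤ L := by
    have h1 : Real.log 2 ≤ L := Real.log_le_log (by norm_num) (by exact_mod_cast hn)
    linarith [Real.log_two_gt_d9]
  have hL4 : 0 < 4 * L + 2 := by linarith
  have hLL : 4 / 9 ≤ L ^ 2 := by nlinarith
  set η := ε / (4 * L + 2) with hη'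
  have hη : 0 < η := div_pos hε hL4
  have hηε : η * (4 * L + 2) = ε := div_mul_cancel₀ _ hL4.ne'
  set τ := 1 / (8 * L₂ * D.cbar + 2 * (2 * D.cbar + 4 * (D.cbar * D.cbar) / η) * (L₁ * L₁))
    with hτ'
  have hden : 0 < 8 * L₂ * D.cbar
    + 2 * (2 * D.cbar + 4 * (D.cbar * D.cbar) / η) * (L₁ * L₁) := by positivity
  have hτ0 : 0 < τ := one_div_pos.2 hden
  have hτ : τ * (2 * D.cbar * L₂ + 4 * D.cbar ^ 2 * L₁ ^ 2 / η) ≤ 1 / 2 := by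
    rw [hτ', one_div, inv_mul_le_iff₀ hden]
    have h1 : 0 ≤ D.cbar * L₁ ^ 2 := by positivity
    have h2 : 0 ≤ D.cbar * L₂ := by positivity
    have h3 : 4 * (D.cbar * D.cbar) / η * (L₁ * L₁) = 4 * D.cbar ^ 2 * L₁ ^ 2 / η := by ring
    linarith
  obtain ⟨thr, hthr⟩ : ∃ thr, thr = η * ε ^ 2 / (200 * D.cbar ^ 3) := ⟨_, rfl⟩
  have hP : (setParams D L₁ L₂ ε).val = ⟨η, τ, thr⟩ := by
    rw [setParams_val, hthr, hτ', hη']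
    congr 1
    ring
  have hinner := inner_count_le hε hεc hη hηε hL hthr
  have houter := outer_count_le hε hεc hη hηε hL hL₁ hL₂ hκ (k := k) (by exact_mod_cast hk1) hτ'
  have hm' : (1 : ℝ) ≤ m := by exact_mod_cast hm
  have hd' : (1 : ℝ) ≤ d := by exact_mod_cast hd
  have hk' : (1 : ℝ) ≤ k := by exact_mod_cast hk1
  set a : ℝ := m * n ^ 2 * d * k with ha
  set b : ℝ := m * n ^ 2 * D.cbar ^ 6 * L ^ 2 / ε ^ 6 with hb
  have ha0 : 0 ≤ a := by positivity
  have hb0 : 0 ≤ b := by positivity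
  have hmna : (m * n ^ 2 : ℝ) ≤ a := by
    rw [ha, mul_assoc]
    exact le_mul_of_one_le_right (by positivity) (one_le_mul_of_one_le_of_one_le hd' hk')
  have hmnd : (m * n ^ 2 * d : ℝ) ≤ a := le_mul_of_one_le_right (by positivity) hk'
  have hB : (25 + (15 + 2 * |A|) * |κ|) * a
      + (5 + 64 * D.cbar / (η * thr)) * (60 * (m * n ^ 2)) ≤ C₁ * (a + b) := by
    have h1 := mul_le_mul_of_nonneg_right hinner (by positivity : (0 : ℝ) ≤ 60 * (m * n ^ 2))
    have h2 : 627200 * (D.cbar ^ 6 * L ^ 2 / ε ^ 6) * (60 * (m * n ^ 2)) = 37632000 * b := by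
      rw [hb]; ring
    have h3 : 0 ≤ (325 + (15 + 2 * |A|) * |κ|) * b := by positivity
    rw [hC₁]
    linarith
  have hiter := fun t U hU => exists_mem_rgaIter D (u₀ := u₀) (v₀ := v₀) hm hk1 hkd hk hretr hops
    hR1 hR2 hε hεc hv₀ hP hη hηε hτ0 hτ hthr t (U := U) hU
  refine ⟨fun t U hU => ?_, fun U₀ hU₀ => ?_⟩
  · obtain ⟨r, hr, hrops, -⟩ := hiter t U hU
    refine ⟨r, hr, hrops.trans (hB.trans ?_)⟩
    refine mul_le_mul_of_nonneg_right ?_ (by positivity)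
    nlinarith
  -- Lyapunov function `η * value`: range `2c̄`, gain `τ ε² / 20` per iteration that goes on.
  · obtain ⟨r, hr, hstat, hrops⟩ := exists_mem_cLoop (body := rgaIter D retr L₁ L₂ ε u₀ v₀)
      (P := fun U => U ∈ Stiefel d k) (Q := D.IsStationary ε)
      (φ := fun U => η * D.value η U) (γ := τ * ε ^ 2 / 20) (K := 2 * D.cbar)
      (B := C₁ * (a + b)) (by positivity)
      (fun U V hU hV => by rw [← mul_sub]; exact value_sub_value_le D hη hc hU hV)
      (by positivity)
      (fun t U hU => by
        obtain ⟨r, hr, hrops, hor⟩ := hiter t U hU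
        exact ⟨r, hr, hrops.trans hB, hor⟩) hU₀
    refine ⟨⟨r.val, (setParams D L₁ L₂ ε).ops + r.ops⟩,
      Part.mem_map_iff _ |>.2 ⟨r, hr, rfl⟩, hstat, ?_⟩
    set F := L ^ 2 * L₁ ^ 2 * D.cbar ^ 4 * k / ε ^ 4 with hF
    have hF1 : 4 / 9 ≤ F := by
      have h1 : 1 ≤ D.cbar ^ 4 / ε ^ 4 := (one_le_div (by positivity)).2 (by gcongr)
      have h2 : 1 ≤ L₁ ^ 2 := one_le_pow₀ hL₁
      have h3 : 1 ≤ L₁ ^ 2 * (D.cbar ^ 4 / ε ^ 4) * k :=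
        one_le_mul_of_one_le_of_one_le (one_le_mul_of_one_le_of_one_le h2 h1) hk'
      have h4 : F = L ^ 2 * (L₁ ^ 2 * (D.cbar ^ 4 / ε ^ 4) * k) := by rw [hF]; ring
      rw [h4]
      exact hLL.trans (le_mul_of_one_le_right (sq_nonneg L) h3)
    have hset : ((setParams D L₁ L₂ ε).ops : ℝ) ≤ 30 * (m * n ^ 2 * d) := by
      exact_mod_cast ops_setParams_le D L₁ L₂ ε hm (by omega) hd
    have h1 := hrops.trans (mul_le_mul_of_nonneg_right houter (by positivity))
    rw [Nat.cast_add, total_eq hε.ne', ← hb, ← hF]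
    exact add_le_total hF1 ha0 hb0 (hset.trans (by linarith)) h1
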